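/- Let $m \ge n \ge 1$ and let $S \subseteq [m]\times[n]$ be a sparsity pattern. Let $A^S$ be the set of real $m\times n$ matrices whose set of nonzero positions is exactly $S$. For $A\in\mathbb{R}^{m\times n}$ put $\mathrm{cospark}(A)=\min_{x\neq 0}\|Ax\|_0$, where $\|\cdot\|_0$ counts nonzero entries, and let $\mathrm{spcospark}(A^S)=\sup_{A\in A^S}\mathrm{cospark}(A)$ be the generic cospark. For $T\subseteq[m]$ let $\mathrm{sprank}(A^S_T)=\sup_{A\in A^S}\mathrm{rank}(A_T)$, where $A_T$ is $A$ restricted to the rows in $T$. Algorithm 1 is the following procedure. Set $X_f=\emptyset$. For every $W\subset[n]$ with $|W|=n-1$ (in any order): let $X_W=\{i\in[m] : (i,j)\in S \Rightarrow j\in W\}$, $T=[m]\setminus X_W$, $B=\emptyset$, $t=\emptyset$; while $\mathrm{sprank}(A^S_{X_W\cup B\cup t})\le n-1$, replace $B$ by $B\cup t$, choose any element of $T$, let $t$ be the set consisting of this element, and remove it from $T$ (the loop also ends if $T$ is empty when an element has to be chosen); then, if $|X_f|<|X_W\cup B|$, set $X_f=X_W\cup B$. Finally return $X_f$ and the number $m-|X_f|$.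 Then: (1) Whatever choices are made, the number $m-|X_f|$ returned by Algorithm 1 equals $\mathrm{spcospark}(A^S)$. (2) Algorithm 1 can be carried out in $\mathcal{O}(nm(1+|S|))$ time: there are a program for a unit-cost random access machine (with increment and decrement as its only arithmetic) and a constant $C$ such that, for all such $m,n,S$, given $m$, $n$, $|S|$ and the elements of $S$ listed in any order, the program carries out a run of Algorithm 1 on $S$, outputting the choices made and the returned set $X_f$, and halts with the result $m-|X_f|=\mathrm{spcospark}(A^S)$ after at most $C\,nm(1+|S|)$ steps. (3) In particular, the generic cospark is computable on this machine in time polynomial in $m$ and $n$. -/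

import Mathlib

namespace GenericCospark

/-! ### Sparsity patterns, generic rank, cospark, generic cospark -/

/-- The set of all real `m × n` matrices whose set of nonzero positions is exactly `S`. -/
def matricesWithPattern {m n : ℕ} (S : Finset (Fin m × Fin n)) :
    Set (Matrix (Fin m) (Fin n) ℝ) :=
  {A | ∀ i j, A i j ≠ 0 ↔ (i, j) ∈ S}

/-- The generic rank of the sparsity pattern `S` restricted to the rows in `T`: the supremum of
the ranks of the row submatrices `A_T`, over all matrices `A` with sparsity pattern `S`. -/
noncomputable def sprank {m n : ℕ} (S : Finset (Fin m × Fin n)) (T : Finset (Fin m)) : ℕ∞ :=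
  ⨆ A ∈ matricesWithPattern S,
    ((A.submatrix (fun i : {i // i ∈ T} => (i : Fin m)) id).rank : ℕ∞)

/-- The cospark of `A`: the least number of nonzero entries of `A x`, over all `x ≠ 0`. -/
noncomputable def cospark {m n : ℕ} (A : Matrix (Fin m) (Fin n) ℝ) : ℕ∞ :=
  ⨅ (x : Fin n → ℝ) (_ : x ≠ 0), (hammingNorm (A.mulVec x) : ℕ∞)

/-- The generic cospark of the sparsity pattern `S`. -/
noncomputable def spcospark {m n : ℕ} (S : Finset (Fin m × Fin n)) : ℕ∞ :=
  ⨆ A ∈ matricesWithPattern S, cospark A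

/-! ### The algorithm

It is nondeterministic (`W` and `t` may be taken in any order), so it is given as a relation
between the pattern, the transcript of the choices made, and the returned set `X_f`. -/

/-- The choices made by the algorithm: `round v` starts the iteration of the outer loop for
`W = Y \ {v}`, and `choose t` takes the element `t` out of `T` in the inner loop. -/
inductive Event (m n : ℕ) : Type
  | round (v : Fin n)
  | choose (t : Fin m)

/-- `X_W`: the rows all of whose neighbours lie in `W`. -/
def rowsWithin {m n : ℕ} (S : Finset (Fin m × Fin n)) (W : Finset (Fin n)) : Finset (Fin m) :=
  Finset.univ.filter fun i => ∀ j, (i, j) ∈ S → j ∈ W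

/-- The inner loop
`while sprank (X_W ∪ B ∪ t) ≤ n - 1 do B := B ∪ t; choose any t from T; T := T \ t`,
where `t` is empty or a singleton. `InnerLoop S XW B T t tr B'` says that, started with `B`, `T`,
`t`, it can end with the value `B'` of `B` after making the choices `tr`. It also ends when a new
element has to be chosen and `T` is empty. -/
inductive InnerLoop {m n : ℕ} (S : Finset (Fin m × Fin n)) (XW : Finset (Fin m)) :
    Finset (Fin m) → Finset (Fin m) → Finset (Fin m) → List (Event m n) → Finset (Fin m) → Prop
  | exit (B T t : Finset (Fin m))
      (hrank : ¬ sprank S (XW ∪ B ∪ t) ≤ ((n - 1 : ℕ) : ℕ∞)) :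
      InnerLoop S XW B T t [] B
  | exhausted (B t : Finset (Fin m))
      (hrank : sprank S (XW ∪ B ∪ t) ≤ ((n - 1 : ℕ) : ℕ∞)) :
      InnerLoop S XW B ∅ t [] (B ∪ t)
  | step (B T t : Finset (Fin m)) (s : Fin m) (tr : List (Event m n)) (B' : Finset (Fin m))
      (hrank : sprank S (XW ∪ B ∪ t) ≤ ((n - 1 : ℕ) : ℕ∞))
      (hs : s ∈ T)
      (hrest : InnerLoop S XW (B ∪ t) (T.erase s) {s} tr B') :
      InnerLoop S XW B T t (Event.choose s :: tr) B'

/-- The outer loop over the remaining sets `Ws`, where `Xf` is the best candidate so far.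
`OuterLoop S Ws Xf tr Xf'` says that it can end with the candidate `Xf'` after making the
choices `tr`. -/
inductive OuterLoop {m n : ℕ} (S : Finset (Fin m × Fin n)) :
    Finset (Finset (Fin n)) → Finset (Fin m) → List (Event m n) → Finset (Fin m) → Prop
  | done (Xf : Finset (Fin m)) : OuterLoop S ∅ Xf [] Xf
  | step (Ws : Finset (Finset (Fin n))) (Xf : Finset (Fin m)) (W : Finset (Fin n)) (v : Fin n)
      (tr₁ tr₂ : List (Event m n)) (B Xf' : Finset (Fin m))
      (hW : W ∈ Ws) (hv : W = Finset.univ.erase v)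
      (hinner : InnerLoop S (rowsWithin S W) ∅ (rowsWithin S W)ᶜ ∅ tr₁ B)
      (hrest : OuterLoop S (Ws.erase W)
        (if Xf.card < (rowsWithin S W ∪ B).card then rowsWithin S W ∪ B else Xf) tr₂ Xf') :
      OuterLoop S Ws Xf (Event.round v :: (tr₁ ++ tr₂)) Xf'

/-- The algorithm, run on the pattern `S`, can make the choices `tr` and return the set `Xf`
(and the number `m - |Xf|`). -/
def AlgorithmRun {m n : ℕ} (S : Finset (Fin m × Fin n)) (tr : List (Event m n))
    (Xf : Finset (Fin m)) : Prop :=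
  OuterLoop S (Finset.powersetCard (n - 1) Finset.univ) ∅ tr Xf

/-! ### The machine model

A random access machine: registers and arrays, numbered by natural numbers and holding natural
numbers, and a write-only output. Every instruction and every test costs one step. A program
mentions finitely many registers and arrays. The only arithmetic is adding and subtracting one,
so no stored number can exceed the largest number in the input and the program by more than the
number of steps made. -/

structure Store : Type where
  reg : ℕ → ℕ
  arr : ℕ → ℕ → ℕ
  out : List (ℕ × ℕ)

inductive Cmd : Type
  /-- do nothing -/
  | skip
  /-- `x := c` -/
  | const (x c : ℕ)
  /-- `x := y` -/
  | copy (x y : ℕ)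
  /-- `x := x + 1` -/
  | inc (x : ℕ)
  /-- `x := x - 1`, truncated at `0` -/
  | dec (x : ℕ)
  /-- `x := a[i]`, with the index in register `i` -/
  | load (x a i : ℕ)
  /-- `a[i] := x`, with the index in register `i` -/
  | store (a i x : ℕ)
  /-- append the pair of the constant `tag` and the value of register `x` to the output -/
  | emit (tag x : ℕ)
  | seq (c d : Cmd)
  /-- `if x < y then c else d` -/
  | ifLt (x y : ℕ) (c d : Cmd)
  /-- `while x < y do c` -/
  | whileLt (x y : ℕ) (c : Cmd)

def Store.setReg (s : Store) (x v : ℕ) : Store :=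
  { s with reg := Function.update s.reg x v }

def Store.setArr (s : Store) (a i v : ℕ) : Store :=
  { s with arr := Function.update s.arr a (Function.update (s.arr a) i v) }

def Store.append (s : Store) (p : ℕ × ℕ) : Store :=
  { s with out := s.out ++ [p] }

/-- `Exec c s k s'`: started in `s`, the program `c` halts in `s'` after exactly `k` steps. -/
inductive Exec : Cmd → Store → ℕ → Store → Prop
  | skip (s : Store) : Exec Cmd.skip s 1 s
  | const (s : Store) (x c : ℕ) : Exec (Cmd.const x c) s 1 (s.setReg x c)
  | copy (s : Store) (x y : ℕ) : Exec (Cmd.copy x y) s 1 (s.setReg x (s.reg y))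
  | inc (s : Store) (x : ℕ) : Exec (Cmd.inc x) s 1 (s.setReg x (s.reg x + 1))
  | dec (s : Store) (x : ℕ) : Exec (Cmd.dec x) s 1 (s.setReg x (s.reg x - 1))
  | load (s : Store) (x a i : ℕ) : Exec (Cmd.load x a i) s 1 (s.setReg x (s.arr a (s.reg i)))
  | store (s : Store) (a i x : ℕ) :
      Exec (Cmd.store a i x) s 1 (s.setArr a (s.reg i) (s.reg x))
  | emit (s : Store) (tag x : ℕ) : Exec (Cmd.emit tag x) s 1 (s.append (tag, s.reg x))
  | seq (c d : Cmd) (s s' s'' : Store) (k l : ℕ) :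
      Exec c s k s' → Exec d s' l s'' → Exec (Cmd.seq c d) s (k + l) s''
  | ifTrue (x y : ℕ) (c d : Cmd) (s s' : Store) (k : ℕ) :
      s.reg x < s.reg y → Exec c s k s' → Exec (Cmd.ifLt x y c d) s (k + 1) s'
  | ifFalse (x y : ℕ) (c d : Cmd) (s s' : Store) (k : ℕ) :
      ¬ s.reg x < s.reg y → Exec d s k s' → Exec (Cmd.ifLt x y c d) s (k + 1) s'
  | whileTrue (x y : ℕ) (c : Cmd) (s s' s'' : Store) (k l : ℕ) :
      s.reg x < s.reg y → Exec c s k s' → Exec (Cmd.whileLt x y c) s' l s'' →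
      Exec (Cmd.whileLt x y c) s (k + l + 1) s''
  | whileFalse (x y : ℕ) (c : Cmd) (s : Store) :
      ¬ s.reg x < s.reg y → Exec (Cmd.whileLt x y c) s 1 s

/-- The initial store for a pattern given by a list `L` of its elements: `m`, `n` and the length
of `L` in registers `0`, `1`, `2`, the row indices in array `0`, the column indices in array `1`,
zeros elsewhere, and no output. -/
def inputStore {m n : ℕ} (L : List (Fin m × Fin n)) : Store where
  reg x := if x = 0 then m else if x = 1 then n else if x = 2 then L.length else 0
  arr a k :=
    if a = 0 then (L.map fun e => (e.1 : ℕ)).getD k 0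
    else if a = 1 then (L.map fun e => (e.2 : ℕ)).getD k 0
    else 0
  out := []

/-- The way in which a choice of the algorithm is written to the output. -/
def Event.code {m n : ℕ} : Event m n → ℕ × ℕ
  | Event.round v => (0, v)
  | Event.choose t => (1, t)

/-- In `k` steps, the program `P`, given the list `L` of the elements of `S`, carries out a run of
the algorithm on `S`: it outputs the choices made in the run and then, in some order, the elements
of the set `Xf` that the run returns, and it halts with `m - |Xf|` in register `0`. -/
def CarriesOutRun {m n : ℕ} (P : Cmd) (S : Finset (Fin m × Fin n)) (L : List (Fin m × Fin n))
    (k : ℕ) (tr : List (Event m n)) (Xf : Finset (Fin m)) : Prop :=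
  AlgorithmRun S tr Xf ∧
    ∃ (s : Store) (R : List (Fin m)), Exec P (inputStore L) k s ∧
      R.Nodup ∧ R.toFinset = Xf ∧
      s.out = tr.map Event.code ++ R.map (fun i => (2, (i : ℕ))) ∧
      s.reg 0 = m - Xf.card

end GenericCospark

/-! View `S` as a bipartite graph between rows and columns. By Hall's theorem, a set `T` of rows
either can be matched onto all columns, or has a violator: a set `J` of columns with fewer than
`|J|` neighbours in `T`. In the second case every matrix with pattern `S` has a nonzero kernel
vector supported on `J` and annihilated by the rows in `T`
(`exists_mulVec_eq_zero_of_not_matchable`). Conversely, a single generic matrix makes all minors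
with a transversal in `S` nonzero (`exists_generic`). Hence the rank test of the algorithm is a
matching test (`sprank_le_iff`), and the generic cospark is `m` minus the largest size of an
unmatchable set (`spcospark_eq`).

Every candidate of the algorithm is unmatchable, so only its size is in question. Let `T` be
unmatchable with violator `J`, choose `v ∈ J`, and let `X` be the candidate for the `W` that omits
`v`. Either `X` contains all rows, or some set `s` of at most one row makes `X ∪ s` matchable. All
rows outside `X` are adjacent to `v`, hence to `J`. Comparing the neighbours of `J` inside `X ∪ s`
and inside `T` gives `|T| ≤ |X|` (`card_le_of_matchable_union`). This uses nothing about the order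
of the choices.

For the running time, matchability is maintained incrementally by an auction. A row at level `l`
takes an adjacent column of price at most `l`, raises that price to `l + 1` and evicts the previous
owner; a row that finds no such column raises its level, and it gives up at level `n`. If a column
stays free, a gap in the prices yields a Hall obstruction (`Auction.not_exists_matching`), so the
auction decides matchability. A potential that weights the levels by the row degrees bounds all
auction steps of one round by `(2 * n + 1) * |S|`. Since rows are only added during a round, all its
rank tests share this budget; the rest of a round is linear in `m + n + |S|`, and there are `n`
rounds.

The program is verified with amortized triples (`Runs`) and syntactic frame conditions
(`Exec.frame`), together with a proof that its output is the transcript of a run. -/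

namespace GenericCospark

open Finset

/-! ### Generic rank, generic cospark and bipartite matchings -/

section Pattern

variable {m n : ℕ} {S : Finset (Fin m × Fin n)}

/-- The rows in `T` can be matched onto all columns along the positions in `S`. -/
def Matchable (S : Finset (Fin m × Fin n)) (T : Finset (Fin m)) : Prop :=
  ∃ f : Fin n → Fin m, Function.Injective f ∧ ∀ j, f j ∈ T ∧ (f j, j) ∈ S

/-- The rows in `T` that are adjacent to some column in `J`. -/
def neighbors (S : Finset (Fin m × Fin n)) (T : Finset (Fin m)) (J : Finset (Fin n)) :
    Finset (Fin m) :=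
  T.filter fun i => ∃ j ∈ J, (i, j) ∈ S

theorem matchable_iff_card_le {T : Finset (Fin m)} :
    Matchable S T ↔ ∀ J : Finset (Fin n), J.card ≤ (neighbors S T J).card := by
  have h := Finset.all_card_le_biUnion_card_iff_exists_injective
    (fun j : Fin n => T.filter fun i => (i, j) ∈ S)
  have hN : ∀ J : Finset (Fin n),
      (J.biUnion fun j => T.filter fun i => (i, j) ∈ S) = neighbors S T J := by
    intro J
    ext i
    simp only [neighbors, mem_biUnion, mem_filter]
    tauto
  simp only [hN, mem_filter] at h
  exact h.symm

theorem Matchable.mono {T T' : Finset (Fin m)} (h : Matchable S T) (hT : T ⊆ T') :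
    Matchable S T' := by
  obtain ⟨f, hf, hfS⟩ := h
  exact ⟨f, hf, fun j => ⟨hT (hfS j).1, (hfS j).2⟩⟩

/-- For a Hall violator `J`, the submatrix on the neighbours of `J` in `T` and the columns `J` has
more columns than rows, hence a kernel vector. Its extension by zero is also annihilated by the
other rows of `T`, which vanish on `J`. -/
theorem exists_mulVec_eq_zero_of_not_matchable {T : Finset (Fin m)} (hT : ¬ Matchable S T)
    {A : Matrix (Fin m) (Fin n) ℝ} (hA : A ∈ matricesWithPattern S) :
    ∃ x : Fin n → ℝ, x ≠ 0 ∧ ∀ i ∈ T, A.mulVec x i = 0 := by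
  rw [matchable_iff_card_le] at hT
  push Not at hT
  obtain ⟨J, hJ⟩ := hT
  let M : Matrix (neighbors S T J) J ℝ := A.submatrix Subtype.val Subtype.val
  have hker : LinearMap.ker M.mulVecLin ≠ ⊥ :=
    LinearMap.ker_ne_bot_of_finrank_lt (by simpa using hJ)
  obtain ⟨y, hy, hy0⟩ := (Submodule.ne_bot_iff _).1 hker
  refine ⟨fun j => if h : j ∈ J then y ⟨j, h⟩ else 0, ?_, ?_⟩
  · intro h0
    apply hy0
    ext j
    have := congrFun h0 j
    simpa using this
  · intro i hi
    have hsum : A.mulVec (fun j => if h : j ∈ J then y ⟨j, h⟩ else 0) i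
        = ∑ j : J, A i j * y j := by
      rw [Matrix.mulVec, dotProduct, ← Finset.sum_subset (Finset.subset_univ J),
        ← Finset.sum_coe_sort J]
      · simp
      · intro j _ hj
        simp [hj]
    rw [hsum]
    by_cases hiN : i ∈ neighbors S T J
    · have := congrFun (LinearMap.mem_ker.1 hy) ⟨i, hiN⟩
      simpa [Matrix.mulVec, dotProduct, M] using this
    · apply Finset.sum_eq_zero
      intro j _
      have : A i j = 0 := by
        by_contra h
        exact hiN (mem_filter.2 ⟨hi, j, j.2, (hA i j).1 h⟩)
      simp [this]

/-- A matrix with pattern `S` all of whose `n × n` minors that admit a transversal in `S` are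
nonzero. -/
theorem exists_generic (S : Finset (Fin m × Fin n)) :
    ∃ A ∈ matricesWithPattern S, ∀ f : Fin n → Fin m, Function.Injective f →
      (∀ j, (f j, j) ∈ S) → (A.submatrix f id).det ≠ 0 := by
  classical
  let X : Matrix (Fin m) (Fin n) (MvPolynomial (Fin m × Fin n) ℝ) :=
    Matrix.of fun i j => if (i, j) ∈ S then MvPolynomial.X (i, j) else 0
  let F : Finset (Fin n → Fin m) :=
    univ.filter fun f => Function.Injective f ∧ ∀ j, (f j, j) ∈ S
  have hdet : ∀ f ∈ F, (X.submatrix f id).det ≠ 0 := by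
    intro f hf h0
    obtain ⟨hinj, hfS⟩ := (mem_filter.1 hf).2
    -- At the indicator of the transversal `f`, the minor becomes the determinant of the identity,
    -- so it is a nonzero polynomial.
    let p : Fin m × Fin n → ℝ := fun e => if e.1 = f e.2 then 1 else 0
    have h1 := congrArg (MvPolynomial.eval p) h0
    rw [RingHom.map_det] at h1
    have h2 : (MvPolynomial.eval p).mapMatrix (X.submatrix f id) = 1 := by
      ext i j
      by_cases hij : i = j
      · subst hij
        simp [X, hfS, p]
      · have : f i ≠ f j := fun h => hij (hinj h)
        by_cases hS : (f i, j) ∈ S <;> simp [X, hS, p, this, hij]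
    rw [h2] at h1
    simp at h1
  -- One point has to avoid the zeros of all minors at once; the product of the variables forces the
  -- entries in `S` to be nonzero as well.
  have hP : (∏ e ∈ S, MvPolynomial.X e) * ∏ f ∈ F, (X.submatrix f id).det
      ≠ (0 : MvPolynomial (Fin m × Fin n) ℝ) := by
    refine mul_ne_zero (Finset.prod_ne_zero_iff.2 fun e _ => MvPolynomial.X_ne_zero e)
      (Finset.prod_ne_zero_iff.2 hdet)
  obtain ⟨a, ha⟩ : ∃ a : Fin m × Fin n → ℝ, MvPolynomial.eval a
      ((∏ e ∈ S, MvPolynomial.X e) * ∏ f ∈ F, (X.submatrix f id).det) ≠ 0 := by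
    by_contra h
    push Not at h
    exact hP (MvPolynomial.funext fun a => by simpa using h a)
  rw [map_mul, map_prod, map_prod, mul_ne_zero_iff, Finset.prod_ne_zero_iff,
    Finset.prod_ne_zero_iff] at ha
  refine ⟨Matrix.of fun i j => if (i, j) ∈ S then a (i, j) else 0, ?_, ?_⟩
  · intro i j
    by_cases hS : (i, j) ∈ S
    · simpa [hS] using ha.1 _ hS
    · simp [hS]
  · intro f hf hfS
    have h := ha.2 f (mem_filter.2 ⟨mem_univ _, hf, hfS⟩)
    rw [RingHom.map_det] at h
    convert h using 2
    ext i j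
    by_cases hS : (f i, j) ∈ S <;> simp [X, hS]

theorem eq_zero_of_det_ne_zero {A : Matrix (Fin m) (Fin n) ℝ} {f : Fin n → Fin m}
    (hf : (A.submatrix f id).det ≠ 0) {x : Fin n → ℝ} (hx : ∀ j, A.mulVec x (f j) = 0) :
    x = 0 :=
  Matrix.eq_zero_of_mulVec_eq_zero hf (funext hx)

/-- The generic matrix has full column rank on a matchable set, while on an unmatchable set every
matrix with the pattern has a kernel vector. -/
theorem sprank_le_iff (hn : 0 < n) {T : Finset (Fin m)} :
    sprank S T ≤ ((n - 1 : ℕ) : ℕ∞) ↔ ¬ Matchable S T := by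
  constructor
  · rintro h ⟨f, hf, hfT⟩
    obtain ⟨A, hA, hgen⟩ := exists_generic S
    have hle := (le_iSup₂_of_le A hA le_rfl).trans h
    have hrank : (A.submatrix (fun i : {i // i ∈ T} => (i : Fin m)) id).rank = n := by
      rw [Matrix.rank, LinearMap.finrank_range_of_inj]
      · simp
      · rw [← LinearMap.ker_eq_bot, LinearMap.ker_eq_bot']
        intro x hx
        exact eq_zero_of_det_ne_zero (hgen f hf fun j => (hfT j).2)
          fun j => congrFun hx ⟨f j, (hfT j).1⟩
    rw [hrank, Nat.cast_le] at hle
    omega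
  · intro h
    refine iSup₂_le fun A hA => ?_
    obtain ⟨x, hx0, hx⟩ := exists_mulVec_eq_zero_of_not_matchable h hA
    let M := A.submatrix (fun i : {i // i ∈ T} => (i : Fin m)) id
    have hker : 0 < Module.finrank ℝ (LinearMap.ker M.mulVecLin) := by
      rw [Module.finrank_pos_iff_exists_ne_zero]
      refine ⟨⟨x, LinearMap.mem_ker.2 (funext fun i => hx i i.2)⟩, fun h => hx0 ?_⟩
      exact congrArg Subtype.val h
    have hadd := LinearMap.finrank_range_add_finrank_ker M.mulVecLin
    rw [Module.finrank_fin_fun] at hadd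
    rw [Nat.cast_le]
    change M.rank ≤ n - 1
    rw [Matrix.rank]
    omega

/-- Upper bound: each matrix has a nonzero `x` with `A x` zero on `X`. Lower bound: for the generic
matrix, the rows where `A x` vanishes cannot be matchable unless `x = 0`. -/
theorem spcospark_eq {X : Finset (Fin m)} (hX : ¬ Matchable S X)
    (hmax : ∀ T, ¬ Matchable S T → T.card ≤ X.card) :
    spcospark S = ((m - X.card : ℕ) : ℕ∞) := by
  have hnorm : ∀ (y : Fin m → ℝ),
      hammingNorm y = m - (univ.filter fun i => y i = 0).card := by
    intro y
    have := Finset.card_filter_add_card_filter_not (s := univ) fun i => y i = 0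
    rw [card_univ, Fintype.card_fin] at this
    have h : hammingNorm y = (univ.filter fun i => ¬ y i = 0).card := by
      rw [hammingNorm]
    omega
  apply le_antisymm
  · refine iSup₂_le fun A hA => ?_
    obtain ⟨x, hx0, hx⟩ := exists_mulVec_eq_zero_of_not_matchable hX hA
    refine (iInf₂_le x hx0).trans ?_
    rw [Nat.cast_le, hnorm]
    exact Nat.sub_le_sub_left
      (card_le_card fun i hi => mem_filter.2 ⟨mem_univ _, hx i hi⟩) _
  · obtain ⟨A, hA, hgen⟩ := exists_generic S
    refine le_iSup₂_of_le A hA (le_iInf₂ fun x hx0 => ?_)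
    rw [Nat.cast_le, hnorm]
    refine Nat.sub_le_sub_left (hmax _ ?_) _
    rintro ⟨f, hf, hfT⟩
    exact hx0 (eq_zero_of_det_ne_zero (hgen f hf fun j => (hfT j).2)
      fun j => (mem_filter.1 (hfT j).1).2)

/-! ### Correctness of the algorithm -/

theorem mem_rowsWithin_erase {v : Fin n} {i : Fin m} :
    i ∈ rowsWithin S (univ.erase v) ↔ (i, v) ∉ S := by
  simp only [rowsWithin, mem_filter, mem_univ, true_and, mem_erase, and_true]
  exact ⟨fun h hv => h v hv rfl, fun h j hj hjv => h (hjv ▸ hj)⟩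

/-- No row of this set is adjacent to the omitted column `v`, so `v` cannot be matched. -/
theorem not_matchable_rowsWithin {v : Fin n} :
    ¬ Matchable S (rowsWithin S (univ.erase v)) := by
  rintro ⟨f, -, hf⟩
  exact mem_rowsWithin_erase.1 (hf v).1 (hf v).2

/-- The inner loop keeps `X_W ∪ B` of deficient generic rank, and it stops only if nothing is left
or one more row would make the rank full. -/
theorem InnerLoop.spec (hn : 0 < n) {XW B T t B' : Finset (Fin m)} {tr : List (Event m n)}
    (h : InnerLoop S XW B T t tr B') (hB : ¬ Matchable S (XW ∪ B))
    (hT : XW ∪ B ∪ t ∪ T = univ) (ht : t.card ≤ 1) :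
    ¬ Matchable S (XW ∪ B') ∧
      (XW ∪ B' = univ ∨ ∃ s : Finset (Fin m), s.card ≤ 1 ∧ Matchable S (XW ∪ B' ∪ s)) := by
  induction h with
  | exit B T t hrank =>
    refine ⟨hB, Or.inr ⟨t, ht, ?_⟩⟩
    rwa [sprank_le_iff hn, not_not] at hrank
  | exhausted B t hrank =>
    rw [sprank_le_iff hn, union_assoc] at hrank
    refine ⟨hrank, Or.inl ?_⟩
    rw [← hT, union_empty, union_assoc]
  | step B T t s tr B' hrank hs hrest ih =>
    rw [sprank_le_iff hn, union_assoc] at hrank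
    refine ih hrank ?_ (by simp)
    rw [← hT]
    ext i
    by_cases hi : i = s
    · subst hi; simp [hs]
    · simp [hi]

/-- The candidate only grows in size, so its final size dominates the set obtained for each `W`
still to come; that set itself need not be returned. -/
theorem OuterLoop.spec (hn : 0 < n) {Ws : Finset (Finset (Fin n))} {Xf Xf' : Finset (Fin m)}
    {tr : List (Event m n)} (h : OuterLoop S Ws Xf tr Xf') (hXf : ¬ Matchable S Xf) :
    ¬ Matchable S Xf' ∧ Xf.card ≤ Xf'.card ∧
      ∀ v : Fin n, univ.erase v ∈ Ws → ∃ X : Finset (Fin m), X.card ≤ Xf'.card ∧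
        rowsWithin S (univ.erase v) ⊆ X ∧
        (X = univ ∨ ∃ s : Finset (Fin m), s.card ≤ 1 ∧ Matchable S (X ∪ s)) := by
  induction h with
  | done Xf => exact ⟨hXf, le_rfl, by simp⟩
  | step Ws Xf W v tr₁ tr₂ B Xf' hW hv hinner hrest ih =>
    subst hv
    obtain ⟨h1, h2⟩ := hinner.spec hn (by simpa using not_matchable_rowsWithin)
      (by simp) (by simp)
    obtain ⟨h3, h4, h5⟩ := ih (by split_ifs <;> assumption)
    have hle : Xf.card ≤ Xf'.card ∧
        (rowsWithin S (univ.erase v) ∪ B).card ≤ Xf'.card := by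
      split_ifs at h4 <;> omega
    refine ⟨h3, hle.1, fun w hw => ?_⟩
    by_cases hwv : univ.erase w = univ.erase v
    · rw [hwv]
      exact ⟨_, hle.2, subset_union_left, h2⟩
    · exact h5 w (mem_erase.2 ⟨hwv, hw⟩)

/-- With `N` the set of all neighbours of `J`: matchability gives `|J| ≤ |N ∩ (X ∪ s)|`, and the
complement of `X ∪ s` lies in `N`, so `|N| ≥ |J| + m - |X ∪ s|`. On the other hand `|N| ≤ |N ∩ T| +
m - |T| < |J| + m - |T|`. Hence `|T| < |X ∪ s| ≤ |X| + 1`. -/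
theorem card_le_of_matchable_union {T X s : Finset (Fin m)} {J : Finset (Fin n)} {v : Fin n}
    (hJ : (neighbors S T J).card < J.card) (hv : v ∈ J)
    (hX : rowsWithin S (univ.erase v) ⊆ X) (hs : s.card ≤ 1) (hXs : Matchable S (X ∪ s)) :
    T.card ≤ X.card := by
  have hXs := matchable_iff_card_le.1 hXs J
  have hcompl : ∀ i ∉ X ∪ s, i ∈ neighbors S univ J := by
    intro i hi
    refine mem_filter.2 ⟨mem_univ _, v, hv, ?_⟩
    by_contra h
    exact hi (mem_union_left _ (hX (mem_rowsWithin_erase.2 h)))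
  have hsub : ∀ Z : Finset (Fin m), neighbors S Z J = Z ∩ neighbors S univ J := by
    intro Z
    ext i
    simp [neighbors]
  have h1 : (neighbors S (X ∪ s) J).card + (X ∪ s)ᶜ.card = (neighbors S univ J).card := by
    rw [← card_union_of_disjoint, hsub]
    · congr 1
      ext i
      have := hcompl i
      simp only [mem_union, mem_inter, mem_compl] at this ⊢
      tauto
    · rw [hsub]
      exact disjoint_left.2 fun i hi hi' => (mem_compl.1 hi') (mem_inter.1 hi).1
  have h2 : (neighbors S univ J).card ≤ (neighbors S T J).card + Tᶜ.card := by
    rw [hsub T]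
    refine (card_le_card fun i hi => ?_).trans (card_union_le _ _)
    by_cases hT : i ∈ T <;> simp [hT, hi]
  have h3 := card_union_le X s
  have h4 := card_add_card_compl T
  have h5 := card_add_card_compl (X ∪ s)
  omega

theorem erase_mem_powersetCard (v : Fin n) :
    univ.erase v ∈ powersetCard (n - 1) (univ : Finset (Fin n)) := by
  simp [mem_powersetCard]

theorem AlgorithmRun.spcospark_eq (hn : 0 < n) {tr : List (Event m n)} {Xf : Finset (Fin m)}
    (h : AlgorithmRun S tr Xf) : ((m - Xf.card : ℕ) : ℕ∞) = spcospark S := by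
  have h0 : ¬ Matchable S ∅ := by
    rintro ⟨f, -, hf⟩
    exact absurd (hf ⟨0, hn⟩).1 (notMem_empty _)
  obtain ⟨h1, -, h2⟩ := OuterLoop.spec hn h h0
  refine (GenericCospark.spcospark_eq h1 fun T hT => ?_).symm
  rw [matchable_iff_card_le] at hT
  push Not at hT
  obtain ⟨J, hJ⟩ := hT
  obtain ⟨v, hv⟩ : J.Nonempty := card_pos.1 (by omega)
  obtain ⟨X, hle, hX, hs⟩ := h2 v (erase_mem_powersetCard v)
  refine le_trans ?_ hle
  rcases hs with rfl | ⟨s, hs, hXs⟩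
  · exact card_le_univ T
  · exact card_le_of_matchable_union hJ hv hX hs hXs

end Pattern

/-! ### Running time of programs -/

namespace Store

variable (s : Store) (x a i v : ℕ) (p : ℕ × ℕ)

@[simp] theorem setReg_reg (y : ℕ) : (s.setReg x v).reg y = if y = x then v else s.reg y := by
  simp [setReg, Function.update_apply]

@[simp] theorem setReg_arr : (s.setReg x v).arr = s.arr := rfl

@[simp] theorem setReg_out : (s.setReg x v).out = s.out := rfl

@[simp] theorem setArr_reg : (s.setArr a i v).reg = s.reg := rfl

@[simp] theorem setArr_arr (b : ℕ) : (s.setArr a i v).arr b =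
    if b = a then Function.update (s.arr a) i v else s.arr b := by
  simp only [setArr, Function.update_apply]

@[simp] theorem setArr_out : (s.setArr a i v).out = s.out := rfl

@[simp] theorem append_reg : (s.append p).reg = s.reg := rfl

@[simp] theorem append_arr : (s.append p).arr = s.arr := rfl

@[simp] theorem append_out : (s.append p).out = s.out ++ [p] := rfl

end Store

namespace Cmd

/-- Sequential composition of a list of commands. -/
def block : List Cmd → Cmd
  | [] => skip
  | c :: cs => seq c (block cs)

/-- The command contains no loop. -/
def loopFree : Cmd → Bool
  | seq c d => c.loopFree && d.loopFree
  | ifLt _ _ c d => c.loopFree && d.loopFree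
  | whileLt _ _ _ => false
  | _ => true

/-- An upper bound for the running time of a command without loops. -/
def cost : Cmd → ℕ
  | seq c d => c.cost + d.cost
  | ifLt _ _ c d => c.cost + d.cost + 1
  | _ => 1

/-- The effect of a command without loops. -/
def eval : Cmd → Store → Store
  | skip, s => s
  | const x c, s => s.setReg x c
  | copy x y, s => s.setReg x (s.reg y)
  | inc x, s => s.setReg x (s.reg x + 1)
  | dec x, s => s.setReg x (s.reg x - 1)
  | load x a i, s => s.setReg x (s.arr a (s.reg i))
  | store a i x, s => s.setArr a (s.reg i) (s.reg x)
  | emit tag x, s => s.append (tag, s.reg x)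
  | seq c d, s => d.eval (c.eval s)
  | ifLt x y c d, s => if s.reg x < s.reg y then c.eval s else d.eval s
  | whileLt _ _ _, s => s

/-- This reduces the verification of code without loops to simplifying `eval`. Only an upper bound
for the time holds, because `cost` charges both branches of a conditional. -/
theorem exec_eval {c : Cmd} (hc : c.loopFree = true) (s : Store) :
    ∃ k ≤ c.cost, Exec c s k (c.eval s) := by
  induction c generalizing s with
  | skip => exact ⟨1, le_rfl, .skip s⟩
  | const x c => exact ⟨1, le_rfl, .const s x c⟩
  | copy x y => exact ⟨1, le_rfl, .copy s x y⟩
  | inc x => exact ⟨1, le_rfl, .inc s x⟩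
  | dec x => exact ⟨1, le_rfl, .dec s x⟩
  | load x a i => exact ⟨1, le_rfl, .load s x a i⟩
  | store a i x => exact ⟨1, le_rfl, .store s a i x⟩
  | emit tag x => exact ⟨1, le_rfl, .emit s tag x⟩
  | seq c d ihc ihd =>
    simp only [loopFree, Bool.and_eq_true] at hc
    obtain ⟨k, hk, h⟩ := ihc hc.1 s
    obtain ⟨l, hl, h'⟩ := ihd hc.2 (c.eval s)
    exact ⟨k + l, add_le_add hk hl, .seq _ _ _ _ _ _ _ h h'⟩
  | ifLt x y c d ihc ihd =>
    simp only [loopFree, Bool.and_eq_true] at hc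
    by_cases hxy : s.reg x < s.reg y
    · obtain ⟨k, hk, h⟩ := ihc hc.1 s
      refine ⟨k + 1, by simp only [cost]; omega, ?_⟩
      rw [eval, if_pos hxy]
      exact .ifTrue _ _ _ _ _ _ _ hxy h
    · obtain ⟨k, hk, h⟩ := ihd hc.2 s
      refine ⟨k + 1, by simp only [cost]; omega, ?_⟩
      rw [eval, if_neg hxy]
      exact .ifFalse _ _ _ _ _ _ _ hxy h
  | whileLt x y c => simp [loopFree] at hc

/-- The command does not write to the register `x`. -/
def keepsReg (x : ℕ) : Cmd → Bool
  | const y _ => y != x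
  | copy y _ => y != x
  | inc y => y != x
  | dec y => y != x
  | load y _ _ => y != x
  | seq c d => c.keepsReg x && d.keepsReg x
  | ifLt _ _ c d => c.keepsReg x && d.keepsReg x
  | whileLt _ _ c => c.keepsReg x
  | _ => true

/-- The command does not write to the array `a`. -/
def keepsArr (a : ℕ) : Cmd → Bool
  | store b _ _ => b != a
  | seq c d => c.keepsArr a && d.keepsArr a
  | ifLt _ _ c d => c.keepsArr a && d.keepsArr a
  | whileLt _ _ c => c.keepsArr a
  | _ => true

/-- The command outputs nothing. -/
def keepsOut : Cmd → Bool
  | emit _ _ => false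
  | seq c d => c.keepsOut && d.keepsOut
  | ifLt _ _ c d => c.keepsOut && d.keepsOut
  | whileLt _ _ c => c.keepsOut
  | _ => true

/-- The two stores agree on everything that `c` never writes. -/
structure Frame (c : Cmd) (s s' : Store) : Prop where
  reg : ∀ x, c.keepsReg x = true → s'.reg x = s.reg x
  arr : ∀ a, c.keepsArr a = true → s'.arr a = s.arr a
  out : c.keepsOut = true → s'.out = s.out

end Cmd

/-- The checks `keepsReg`, `keepsArr` and `keepsOut` are computable, so for a concrete command each
preservation fact, even across loops, is proved by `rfl`. -/
theorem Exec.frame {c : Cmd} {s s' : Store} {k : ℕ} (h : Exec c s k s') : c.Frame s s' := by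
  induction h with
  | skip s => exact ⟨fun _ _ => rfl, fun _ _ => rfl, fun _ => rfl⟩
  | const s x c =>
    refine ⟨fun y hy => ?_, fun _ _ => rfl, fun _ => rfl⟩
    simp only [Cmd.keepsReg, bne_iff_ne] at hy
    simp [hy.symm]
  | copy s x c =>
    refine ⟨fun y hy => ?_, fun _ _ => rfl, fun _ => rfl⟩
    simp only [Cmd.keepsReg, bne_iff_ne] at hy
    simp [hy.symm]
  | inc s x =>
    refine ⟨fun y hy => ?_, fun _ _ => rfl, fun _ => rfl⟩
    simp only [Cmd.keepsReg, bne_iff_ne] at hy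
    simp [hy.symm]
  | dec s x =>
    refine ⟨fun y hy => ?_, fun _ _ => rfl, fun _ => rfl⟩
    simp only [Cmd.keepsReg, bne_iff_ne] at hy
    simp [hy.symm]
  | load s x a i =>
    refine ⟨fun y hy => ?_, fun _ _ => rfl, fun _ => rfl⟩
    simp only [Cmd.keepsReg, bne_iff_ne] at hy
    simp [hy.symm]
  | store s a i x =>
    refine ⟨fun _ _ => rfl, fun b hb => ?_, fun _ => rfl⟩
    simp only [Cmd.keepsArr, bne_iff_ne] at hb
    simp [hb.symm]
  | emit s tag x =>
    exact ⟨fun _ _ => rfl, fun _ _ => rfl, fun h => by simp [Cmd.keepsOut] at h⟩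
  | seq c d s s' s'' k l _ _ ih ih' =>
    refine ⟨fun y hy => ?_, fun b hb => ?_, fun h => ?_⟩
    · simp only [Cmd.keepsReg, Bool.and_eq_true] at hy
      rw [ih'.reg y hy.2, ih.reg y hy.1]
    · simp only [Cmd.keepsArr, Bool.and_eq_true] at hb
      rw [ih'.arr b hb.2, ih.arr b hb.1]
    · simp only [Cmd.keepsOut, Bool.and_eq_true] at h
      rw [ih'.out h.2, ih.out h.1]
  | ifTrue x y c d s s' k _ _ ih =>
    refine ⟨fun y hy => ?_, fun b hb => ?_, fun h => ?_⟩
    · simp only [Cmd.keepsReg, Bool.and_eq_true] at hy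
      exact ih.reg y hy.1
    · simp only [Cmd.keepsArr, Bool.and_eq_true] at hb
      exact ih.arr b hb.1
    · simp only [Cmd.keepsOut, Bool.and_eq_true] at h
      exact ih.out h.1
  | ifFalse x y c d s s' k _ _ ih =>
    refine ⟨fun y hy => ?_, fun b hb => ?_, fun h => ?_⟩
    · simp only [Cmd.keepsReg, Bool.and_eq_true] at hy
      exact ih.reg y hy.2
    · simp only [Cmd.keepsArr, Bool.and_eq_true] at hb
      exact ih.arr b hb.2
    · simp only [Cmd.keepsOut, Bool.and_eq_true] at h
      exact ih.out h.2
  | whileTrue x y c s s' s'' k l _ _ _ ih ih' =>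
    refine ⟨fun y hy => ?_, fun b hb => ?_, fun h => ?_⟩
    · rw [ih'.reg y hy, ih.reg y hy]
    · rw [ih'.arr b hb, ih.arr b hb]
    · rw [ih'.out h, ih.out h]
  | whileFalse x y c s _ => exact ⟨fun _ _ => rfl, fun _ _ => rfl, fun _ => rfl⟩

/-- Started in `s`, the command `c` halts in a store satisfying `Q`, in amortized time at most `K`
with respect to the potential `Φ`. -/
def Runs (Φ : Store → ℕ) (c : Cmd) (s : Store) (K : ℕ) (Q : Store → Prop) : Prop :=
  ∃ k s', Exec c s k s' ∧ k + Φ s' ≤ K + Φ s ∧ Q s'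

namespace Runs

variable {Φ : Store → ℕ} {c d : Cmd} {s : Store} {K L : ℕ} {Q R : Store → Prop}

theorem of_eval (hc : c.loopFree = true) (hΦ : Φ (c.eval s) + c.cost ≤ K + Φ s)
    (hQ : Q (c.eval s)) : Runs Φ c s K Q := by
  obtain ⟨k, hk, h⟩ := Cmd.exec_eval hc s
  exact ⟨k, _, h, by omega, hQ⟩

theorem mono (h : Runs Φ c s K R) (hK : K ≤ L) (hQ : ∀ s', c.Frame s s' → R s' → Q s') :
    Runs Φ c s L Q := by
  obtain ⟨k, s', he, hk, hR⟩ := h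
  exact ⟨k, s', he, by omega, hQ s' he.frame hR⟩

/-- Passing the frame of `c` on to the second command spares every postcondition from listing what
is left unchanged. -/
theorem seq (h : Runs Φ c s K R) (h' : ∀ s', c.Frame s s' → R s' → Runs Φ d s' L Q) :
    Runs Φ (Cmd.seq c d) s (K + L) Q := by
  obtain ⟨k, s', he, hk, hR⟩ := h
  obtain ⟨l, s'', he', hl, hQ⟩ := h' s' he.frame hR
  exact ⟨k + l, s'', .seq _ _ _ _ _ _ _ he he', by omega, hQ⟩

theorem ifLt {x y : ℕ} (h : s.reg x < s.reg y → Runs Φ c s K Q)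
    (h' : ¬ s.reg x < s.reg y → Runs Φ d s K Q) : Runs Φ (Cmd.ifLt x y c d) s (K + 1) Q := by
  by_cases hxy : s.reg x < s.reg y
  · obtain ⟨k, s', he, hk, hQ⟩ := h hxy
    exact ⟨k + 1, s', .ifTrue _ _ _ _ _ _ _ hxy he, by omega, hQ⟩
  · obtain ⟨k, s', he, hk, hQ⟩ := h' hxy
    exact ⟨k + 1, s', .ifFalse _ _ _ _ _ _ _ hxy he, by omega, hQ⟩

/-- The potential `0` may be replaced by one that does not grow. -/
theorem of_zero (h : Runs (fun _ => 0) c s K R) (hΦ : ∀ s', c.Frame s s' → R s' → Φ s' ≤ Φ s)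
    (hQ : ∀ s', c.Frame s s' → R s' → Q s') : Runs Φ c s K Q := by
  obtain ⟨k, s', he, hk, hR⟩ := h
  simp only [add_zero] at hk
  have := hΦ s' he.frame hR
  exact ⟨k, s', he, by omega, hQ s' he.frame hR⟩

/-- The initial potential is turned into actual running time, once the amortized argument is
finished. -/
theorem to_zero (h : Runs Φ c s K Q) (hL : K + Φ s ≤ L) : Runs (fun _ => 0) c s L Q := by
  obtain ⟨k, s', he, hk, hQ⟩ := h
  exact ⟨k, s', he, by simp only; omega, hQ⟩

/-- A loop whose counter runs from its current value `t` to `B`. -/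
theorem counter_aux {i b B : ℕ} (Inv : ℕ → Store → Prop)
    (hstep : ∀ t s, t < B → s.reg i = t → s.reg b = B → Inv t s →
      Runs Φ c s K fun s' => s'.reg i = t + 1 ∧ s'.reg b = B ∧ Inv (t + 1) s')
    (r t : ℕ) (hr : t + r = B) (s : Store) (hi : s.reg i = t) (hb : s.reg b = B)
    (h : Inv t s) : Runs Φ (Cmd.whileLt i b c) s (r * (K + 1) + 1) (Inv B) := by
  induction r generalizing t s with
  | zero =>
    obtain rfl : t = B := by omega
    exact ⟨1, s, .whileFalse _ _ _ _ (by omega), by omega, h⟩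
  | succ r ih =>
    obtain ⟨k, s', he, hk, h1, h2, h3⟩ := hstep t s (by omega) hi hb h
    obtain ⟨l, s'', he', hl, hQ⟩ := ih (t + 1) (by omega) s' h1 h2 h3
    refine ⟨k + l + 1, s'', .whileTrue _ _ _ _ _ _ _ _ (by omega) he he', ?_, hQ⟩
    rw [add_mul, one_mul]
    omega

theorem counter {i b B : ℕ} (Inv : ℕ → Store → Prop) (hi : s.reg i = 0) (hb : s.reg b = B)
    (h : Inv 0 s)
    (hstep : ∀ t s, t < B → s.reg i = t → s.reg b = B → Inv t s →
      Runs Φ c s K fun s' => s'.reg i = t + 1 ∧ s'.reg b = B ∧ Inv (t + 1) s') :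
    Runs Φ (Cmd.whileLt i b c) s (B * (K + 1) + 1) (Inv B) :=
  counter_aux Inv hstep B 0 (by omega) s hi hb h

/-- A loop each of whose iterations is paid for by the potential. -/
theorem while_potential {x y : ℕ} (Inv : Store → Prop) (h : Inv s)
    (hstep : ∀ s, s.reg x < s.reg y → Inv s →
      ∃ k s', Exec c s k s' ∧ k + 1 + Φ s' ≤ Φ s ∧ Inv s') :
    Runs Φ (Cmd.whileLt x y c) s 1 fun s' => Inv s' ∧ ¬ s'.reg x < s'.reg y := by
  -- Each iteration costs at least its own test, so the potential strictly decreases.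
  induction hN : Φ s using Nat.strong_induction_on generalizing s with
  | _ N ih =>
    by_cases hxy : s.reg x < s.reg y
    · obtain ⟨k, s', he, hk, hI⟩ := hstep s hxy h
      obtain ⟨l, s'', he', hl, hQ⟩ := ih (Φ s') (by omega) hI rfl
      exact ⟨k + l + 1, s'', .whileTrue _ _ _ _ _ _ _ _ hxy he he', by omega, hQ⟩
    · exact ⟨1, s, .whileFalse _ _ _ _ hxy, le_rfl, h, hxy⟩

end Runs

/-! ### Bipartite matching by an auction

The edges `e < N` join the rows `row e` to the columns `col e`. A row that is to be matched looks
for a column whose price is at most its own level; it then raises the price above its level and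
evicts the former owner of the column. A row scans its edges cyclically and raises its level after
each full scan; it gives up at level `n`. -/

/-- One more than the last edge of row `i` before `e`, or zero if there is none. -/
def prevEdge (row : ℕ → ℕ) (i : ℕ) : ℕ → ℕ
  | 0 => 0
  | e + 1 => if row e = i then e + 1 else prevEdge row i e

section prevEdge

variable {row : ℕ → ℕ} {i : ℕ}

theorem prevEdge_le (e : ℕ) : prevEdge row i e ≤ e := by
  induction e with
  | zero => exact le_rfl
  | succ e ih => rw [prevEdge]; split_ifs <;> omega

theorem row_of_prevEdge {e q : ℕ} (h : prevEdge row i e = q + 1) : row q = i := by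
  induction e with
  | zero => simp [prevEdge] at h
  | succ e ih =>
    rw [prevEdge] at h
    split_ifs at h with he
    · obtain rfl : e = q := by omega
      exact he
    · exact ih h

theorem lt_prevEdge {e f : ℕ} (hf : f < e) (hi : row f = i) : f < prevEdge row i e := by
  induction e with
  | zero => omega
  | succ e ih =>
    rw [prevEdge]
    split_ifs with he
    · omega
    · refine ih ?_
      rcases Nat.lt_succ_iff_lt_or_eq.1 hf with h | rfl
      · exact h
      · exact absurd hi he

/-- No edge of row `i` lies between `prevEdge row i e` and `e`. Thus moving a pointer back to the
previous edge does not change the number of edges counted below it. -/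
theorem count_prevEdge (e : ℕ) :
    Nat.count (fun f => row f = i) (prevEdge row i e) = Nat.count (fun f => row f = i) e := by
  induction e with
  | zero => rfl
  | succ e ih =>
    rw [prevEdge]
    split_ifs with he
    · rfl
    · rw [ih, Nat.count_succ, if_neg he, add_zero]

end prevEdge

section potential

variable {row lv ptr lv' ptr' : ℕ → ℕ} {m n N c : ℕ}

/-- The work that the row `i` can still cause. -/
def rowPotential (row : ℕ → ℕ) (n N i level pos : ℕ) : ℕ :=
  2 * (n - level) * Nat.count (fun f => row f = i) N + Nat.count (fun f => row f = i) pos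

/-- A bound for the number of steps of the auction that remain. -/
def potential (row : ℕ → ℕ) (m n N : ℕ) (lv ptr : ℕ → ℕ) : ℕ :=
  ∑ i ∈ range m, rowPotential row n N i (lv i) (ptr i)

theorem sum_count_row (hrow : ∀ e < N, row e < m) :
    ∑ i ∈ range m, Nat.count (fun f => row f = i) N = N := by
  induction N with
  | zero => simp
  | succ N ih =>
    simp only [Nat.count_succ, sum_add_distrib]
    rw [ih fun e he => hrow e (by omega), sum_ite_eq, if_pos (mem_range.2 (hrow N (by omega)))]

theorem potential_init (hrow : ∀ e < N, row e < m) (hlv : ∀ i < m, lv i = 0)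
    (hptr : ∀ i < m, ptr i = prevEdge row i N) :
    potential row m n N lv ptr = (2 * n + 1) * N := by
  rw [potential]
  -- Each row starts with `2 * n + 1` times its degree, and the degrees add up to `N`.
  conv_rhs => rw [← sum_count_row hrow, mul_sum]
  refine sum_congr rfl fun i hi => ?_
  rw [mem_range] at hi
  rw [hlv i hi, hptr i hi, rowPotential, count_prevEdge]
  simp only [Nat.sub_zero]
  ring

theorem potential_lt (hc : c < m) (hne : ∀ i ≠ c, lv' i = lv i ∧ ptr' i = ptr i)
    (h : rowPotential row n N c (lv' c) (ptr' c) < rowPotential row n N c (lv c) (ptr c)) :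
    potential row m n N lv' ptr' < potential row m n N lv ptr := by
  refine sum_lt_sum (fun i _ => ?_) ⟨c, mem_range.2 hc, h⟩
  by_cases hi : i = c
  · subst hi
    exact h.le
  · rw [(hne i hi).1, (hne i hi).2]

end potential

/-- The invariant of the auction for the set `R` of rows, where the row `cur - 1` is looking for a
column if `cur ≠ 0`, the column `j` is owned by the row `owner j - 1` if `owner j ≠ 0`, the edges
of the row `i` below `ptr i` remain to be scanned at the level `lv i`, and `cnt` columns are
owned. -/
structure Auction (row col : ℕ → ℕ) (m n N : ℕ) (R : Finset ℕ) (price owner lv ptr : ℕ → ℕ)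
    (cur cnt : ℕ) : Prop where
  row_lt : ∀ e < N, row e < m
  col_lt : ∀ e < N, col e < n
  le_price : ∀ e < N, lv (row e) ≤ price (col e)
  lt_price : ∀ e < N, ptr (row e) ≤ e → lv (row e) < price (col e)
  owner_eq_zero : ∀ j < n, owner j = 0 ↔ price j = 0
  owner_mem : ∀ j < n, ∀ i, owner j = i + 1 → i ∈ R
  owner_ne : ∀ j < n, owner j ≠ 0 → owner j ≠ cur
  owner_adj : ∀ j < n, ∀ i, owner j = i + 1 → ∃ e < N, row e = i ∧ col e = j
  owner_lv : ∀ j < n, ∀ i, owner j = i + 1 → price j ≤ lv i + 1 ∧ lv i < n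
  owner_inj : ∀ j < n, ∀ j' < n, owner j ≠ 0 → owner j = owner j' → j = j'
  settled : ∀ i ∈ R, i + 1 = cur ∨ (∃ j < n, owner j = i + 1) ∨
    ∀ e < N, row e = i → n ≤ price (col e)
  cnt_eq : cnt = ((range n).filter fun j => owner j ≠ 0).card
  cur_mem : ∀ i, cur = i + 1 → i ∈ R
  cur_lv : ∀ i, cur = i + 1 → lv i < n
  cur_adj : ∀ i, cur = i + 1 → ∃ e < N, row e = i
  lv_eq_zero : ∀ i < m, i ∉ R → lv i = 0
  ptr_row : ∀ i < m, ∀ q, ptr i = q + 1 → q < N ∧ row q = i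

namespace Auction

variable {row col price owner lv ptr : ℕ → ℕ} {m n N cur cnt c q : ℕ} {R : Finset ℕ}

theorem init (hrow : ∀ e < N, row e < m) (hcol : ∀ e < N, col e < n)
    (hprice : ∀ j < n, price j = 0) (howner : ∀ j < n, owner j = 0)
    (hlv : ∀ i < m, lv i = 0) (hptr : ∀ i < m, ptr i = prevEdge row i N) :
    Auction row col m n N ∅ price owner lv ptr 0 0 where
  row_lt := hrow
  col_lt := hcol
  le_price e he := by simp [hlv _ (hrow e he)]
  lt_price e he h := by
    have := lt_prevEdge he (rfl : row e = row e)
    rw [hptr _ (hrow e he)] at h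
    omega
  owner_eq_zero j hj := by simp [hprice j hj, howner j hj]
  owner_mem j hj i h := by simp [howner j hj] at h
  owner_ne j hj h := by simp [howner j hj] at h
  owner_adj j hj i h := by simp [howner j hj] at h
  owner_lv j hj i h := by simp [howner j hj] at h
  owner_inj j hj j' _ h := by simp [howner j hj] at h
  settled i h := by simp at h
  cnt_eq := by
    rw [filter_false_of_mem, card_empty]
    intro j hj
    simp [howner j (mem_range.1 hj)]
  cur_mem i h := by omega
  cur_lv i h := by omega
  cur_adj i h := by omega
  lv_eq_zero i hi _ := hlv i hi
  ptr_row i hi q h := by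
    rw [hptr i hi] at h
    have := prevEdge_le (row := row) (i := i) N
    exact ⟨by omega, row_of_prevEdge h⟩

/-- A row without edges must not search: its potential is zero, so it could not pay for raising its
level. It counts as having given up, vacuously. -/
theorem insert_isolated (h : Auction row col m n N R price owner lv ptr 0 cnt) {i : ℕ}
    (hi : ∀ e < N, row e ≠ i) : Auction row col m n N (insert i R) price owner lv ptr 0 cnt where
  __ := h
  owner_mem j hj i' hi' := mem_insert_of_mem (h.owner_mem j hj i' hi')
  settled i' hi' := by
    rcases mem_insert.1 hi' with rfl | hi'
    · exact Or.inr (Or.inr fun e he hei => absurd hei (hi e he))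
    · exact h.settled i' hi'
  cur_mem i h := by omega
  lv_eq_zero i' hm hi' := h.lv_eq_zero i' hm fun h => hi' (mem_insert_of_mem h)

theorem insert_row (hn : 0 < n) (h : Auction row col m n N R price owner lv ptr 0 cnt) {i : ℕ}
    (hiR : i ∉ R) (hi : ∃ e < N, row e = i) :
    Auction row col m n N (insert i R) price owner lv ptr (i + 1) cnt where
  __ := h
  owner_mem j hj i' hi' := mem_insert_of_mem (h.owner_mem j hj i' hi')
  owner_ne j hj _ h' := hiR (h.owner_mem j hj i h')
  settled i' hi' := by
    rcases mem_insert.1 hi' with rfl | hi'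
    · exact Or.inl rfl
    · rcases h.settled i' hi' with h | h
      · omega
      · exact Or.inr h
  cur_mem i' h' := by
    obtain rfl : i = i' := by omega
    exact mem_insert_self _ _
  cur_lv i' h' := by
    obtain rfl : i = i' := by omega
    obtain ⟨e, he, rfl⟩ := hi
    -- A row that has not been inserted before is still at level zero.
    rw [h.lv_eq_zero _ (h.row_lt e he) hiR]
    exact hn
  cur_adj i' h' := by
    obtain rfl : i = i' := by omega
    exact hi
  lv_eq_zero i' hm hi' := h.lv_eq_zero i' hm fun h => hi' (mem_insert_of_mem h)

theorem cur_lt (h : Auction row col m n N R price owner lv ptr (c + 1) cnt) : c < m := by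
  obtain ⟨e, he, rfl⟩ := h.cur_adj c rfl
  exact h.row_lt e he

/-- The edge `q` has been scanned in vain. -/
theorem skip_edge (h : Auction row col m n N R price owner lv ptr (c + 1) cnt)
    (hq : ptr c = q + 1) (hp : lv c < price (col q)) :
    Auction row col m n N R price owner lv (Function.update ptr c (prevEdge row c q))
      (c + 1) cnt where
  __ := h
  lt_price e he hle := by
    by_cases hc : row e = c
    · subst hc
      rw [Function.update_self] at hle
      by_cases heq : e = q
      · subst heq; exact hp
      -- An edge of this row before `q` also lies below the new pointer, so apart from `q` no edge
      -- is newly counted as scanned.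
      · refine h.lt_price e he ?_
        by_contra hlt
        have := lt_prevEdge (show e < q by omega) (rfl : row e = row e)
        omega
    · rw [Function.update_of_ne hc] at hle
      exact h.lt_price e he hle
  ptr_row i hm p hp := by
    by_cases hc : i = c
    · subst hc
      rw [Function.update_self] at hp
      have := prevEdge_le (row := row) (i := i) q
      have := h.ptr_row i hm q hq
      exact ⟨by omega, row_of_prevEdge hp⟩
    · rw [Function.update_of_ne hc] at hp
      exact h.ptr_row i hm p hp

/-- The row `c` takes the column `col q`. -/
theorem bid (h : Auction row col m n N R price owner lv ptr (c + 1) cnt)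
    (hq : ptr c = q + 1) (hp : price (col q) ≤ lv c) :
    Auction row col m n N R (Function.update price (col q) (lv c + 1))
      (Function.update owner (col q) (c + 1)) lv (Function.update ptr c (prevEdge row c q))
      (owner (col q)) (if 0 < owner (col q) then cnt else cnt + 1) := by
  obtain ⟨hqN, hqc⟩ := h.ptr_row c h.cur_lt q hq
  have hj := h.col_lt q hqN
  -- Prices never fall, so every lower bound on prices in the invariant survives.
  have hmono : ∀ j, price j ≤ Function.update price (col q) (lv c + 1) j := by
    intro j
    by_cases hjq : j = col q
    · subst hjq; rw [Function.update_self]; omega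
    · rw [Function.update_of_ne hjq]
  have hown : ∀ j i, Function.update owner (col q) (c + 1) j = i + 1 →
      (j = col q ∧ i = c) ∨ (j ≠ col q ∧ owner j = i + 1) := by
    intro j i hji
    by_cases hjq : j = col q
    · subst hjq; rw [Function.update_self] at hji; exact Or.inl ⟨rfl, by omega⟩
    · rw [Function.update_of_ne hjq] at hji; exact Or.inr ⟨hjq, hji⟩
  refine ⟨h.row_lt, h.col_lt, ?_, ?_, ?_, ?_, ?_, ?_, ?_, ?_, ?_, ?_, ?_, ?_, ?_, ?_, ?_⟩
  · intro e he
    exact (h.le_price e he).trans (hmono _)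
  · intro e he hle
    by_cases hec : row e = c
    · by_cases heq : e = q
      -- The edge `q` now counts as scanned, rightly so, since its column costs one more than the
      -- level of `c`.
      · subst heq; rw [Function.update_self, hec]; omega
      · refine (h.lt_price e he ?_).trans_le (hmono _)
        by_contra hlt
        rw [hec, Function.update_self] at hle
        rw [hec] at hlt
        have := lt_prevEdge (show e < q by omega) hec
        omega
    · rw [Function.update_of_ne hec] at hle
      exact (h.lt_price e he hle).trans_le (hmono _)
  · intro j hj'
    by_cases hjq : j = col q
    · subst hjq; simp
    · rw [Function.update_of_ne hjq, Function.update_of_ne hjq]; exact h.owner_eq_zero j hj'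
  · intro j hj' i hi
    rcases hown j i hi with ⟨-, rfl⟩ | ⟨-, h'⟩
    · exact h.cur_mem i rfl
    · exact h.owner_mem j hj' i h'
  · intro j hj' h0
    by_cases hjq : j = col q
    · subst hjq
      rw [Function.update_self]
      intro h'
      exact h.owner_ne _ hj (by omega) h'.symm
    · rw [Function.update_of_ne hjq] at h0 ⊢
      -- The evicted row owned no other column, so as the new searching row it owns none.
      exact fun h' => hjq (h.owner_inj j hj' _ hj h0 h')
  · intro j hj' i hi
    rcases hown j i hi with ⟨rfl, rfl⟩ | ⟨-, h'⟩
    · exact ⟨q, hqN, hqc, rfl⟩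
    · exact h.owner_adj j hj' i h'
  · intro j hj' i hi
    rcases hown j i hi with ⟨rfl, rfl⟩ | ⟨hne, h'⟩
    · rw [Function.update_self]; exact ⟨le_rfl, h.cur_lv i rfl⟩
    · rw [Function.update_of_ne hne]; exact h.owner_lv j hj' i h'
  · intro j hj' j' hj'' h0 heq
    obtain ⟨i, hi⟩ := Nat.exists_eq_succ_of_ne_zero h0
    rw [hi] at heq
    rcases hown j i hi with ⟨h1, h2⟩ | ⟨h1, h2⟩ <;>
      rcases hown j' i heq.symm with ⟨h3, h4⟩ | ⟨h3, h4⟩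
    · rw [h1, h3]
    · exact absurd (by rw [h4, h2]) (h.owner_ne j' hj'' (by omega))
    · exact absurd (by rw [h4] at h2; exact h2) (h.owner_ne j hj' (by omega))
    · exact h.owner_inj j hj' j' hj'' (by omega) (by omega)
  · intro i hi
    -- The searching row becomes an owner, the evicted owner becomes the searching row, and all
    -- others keep their status.
    rcases h.settled i hi with h' | ⟨j, hj', h'⟩ | h'
    · exact Or.inr (Or.inl ⟨col q, hj, by rw [Function.update_self, h']⟩)
    · by_cases hjq : j = col q
      · subst hjq; exact Or.inl h'.symm
      · exact Or.inr (Or.inl ⟨j, hj', by rw [Function.update_of_ne hjq, h']⟩)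
    · exact Or.inr (Or.inr fun e he hei => (h' e he hei).trans (hmono _))
  · rw [h.cnt_eq]
    have hins : (range n).filter (fun j => Function.update owner (col q) (c + 1) j ≠ 0) =
        insert (col q) ((range n).filter fun j => owner j ≠ 0) := by
      ext j
      by_cases hjq : j = col q
      · subst hjq; simp [hj]
      · simp [hjq]
    rw [hins]
    split_ifs with h0
    · rw [insert_eq_of_mem]
      simp [hj]
      omega
    · rw [card_insert_of_notMem]
      simp
      omega
  · intro i hi
    exact h.owner_mem _ hj i hi
  · intro i hi
    exact (h.owner_lv _ hj i hi).2
  · intro i hi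
    obtain ⟨e, he, h1, -⟩ := h.owner_adj _ hj i hi
    exact ⟨e, he, h1⟩
  · exact h.lv_eq_zero
  · intro i hm p hp'
    by_cases hc : i = c
    · subst hc
      rw [Function.update_self] at hp'
      have := prevEdge_le (row := row) (i := i) q
      exact ⟨by omega, row_of_prevEdge hp'⟩
    · rw [Function.update_of_ne hc] at hp'
      exact h.ptr_row i hm p hp'

/-- The row `c` has scanned all its edges, and it raises its level. -/
theorem raise_level (h : Auction row col m n N R price owner lv ptr (c + 1) cnt)
    (hq : ptr c = 0) :
    Auction row col m n N R price owner (Function.update lv c (lv c + 1))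
      (Function.update ptr c (prevEdge row c N)) (if lv c + 1 < n then c + 1 else 0) cnt := by
  -- The pointer is at zero, so all edges of `c` have been scanned and all its columns cost more
  -- than its level.
  have hlt : ∀ e < N, row e = c → lv c + 1 ≤ price (col e) := by
    intro e he hec
    have := h.lt_price e he (by rw [hec, hq]; omega)
    rwa [hec] at this
  have hne : ∀ j < n, ∀ i, owner j = i + 1 → i ≠ c := by
    rintro j hj i hi rfl
    exact h.owner_ne j hj (by omega) hi
  refine ⟨h.row_lt, h.col_lt, ?_, ?_, ?_, ?_, ?_, ?_, ?_, ?_, ?_, ?_, ?_, ?_, ?_, ?_, ?_⟩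
  · intro e he
    by_cases hec : row e = c
    · rw [hec, Function.update_self]; exact hlt e he hec
    · rw [Function.update_of_ne hec]; exact h.le_price e he
  · intro e he hle
    by_cases hec : row e = c
    · rw [hec, Function.update_self] at hle
      have := lt_prevEdge he hec
      omega
    · rw [Function.update_of_ne hec] at hle ⊢
      exact h.lt_price e he hle
  · exact h.owner_eq_zero
  · exact h.owner_mem
  · intro j hj h0
    split_ifs
    · exact h.owner_ne j hj h0
    · exact h0
  · exact h.owner_adj
  · intro j hj i hi
    rw [Function.update_of_ne (hne j hj i hi)]
    exact h.owner_lv j hj i hi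
  · exact h.owner_inj
  · intro i hi
    rcases h.settled i hi with h' | h'
    · obtain rfl : i = c := by omega
      split_ifs with hn
      · exact Or.inl rfl
      -- The row reaches level `n` and gives up; its columns all cost at least `n`.
      · exact Or.inr (Or.inr fun e he hei => by have := hlt e he hei; omega)
    · exact Or.inr h'
  · exact h.cnt_eq
  · intro i hi
    split_ifs at hi with hn
    exact h.cur_mem i hi
  · intro i hi
    split_ifs at hi with hn
    obtain rfl : i = c := by omega
    rw [Function.update_self]
    exact hn
  · intro i hi
    split_ifs at hi with hn
    exact h.cur_adj i hi
  · intro i hm hi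
    have hic : i ≠ c := fun hic => hi (hic ▸ h.cur_mem c rfl)
    rw [Function.update_of_ne hic]
    exact h.lv_eq_zero i hm hi
  · intro i hm p hp'
    by_cases hc : i = c
    · subst hc
      rw [Function.update_self] at hp'
      have := prevEdge_le (row := row) (i := i) N
      exact ⟨by omega, row_of_prevEdge hp'⟩
    · rw [Function.update_of_ne hc] at hp'
      exact h.ptr_row i hm p hp'

theorem cnt_le (h : Auction row col m n N R price owner lv ptr cur cnt) : cnt ≤ n := by
  rw [h.cnt_eq]
  exact (card_filter_le _ _).trans (card_range n).le

theorem exists_matching (h : Auction row col m n N R price owner lv ptr cur cnt) (hcnt : cnt = n) :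
    ∃ f : ℕ → ℕ, Set.InjOn f {j | j < n} ∧
      ∀ j < n, f j ∈ R ∧ ∃ e < N, row e = f j ∧ col e = j := by
  have hpos : ∀ j < n, owner j = owner j - 1 + 1 := by
    intro j hj
    have hall : (range n).filter (fun j => owner j ≠ 0) = range n :=
      eq_of_subset_of_card_le (filter_subset _ _)
        (by rw [← h.cnt_eq, hcnt, card_range])
    have := (mem_filter.1 (hall.symm ▸ mem_range.2 hj : j ∈ filter _ _)).2
    omega
  refine ⟨fun j => owner j - 1, fun j hj j' hj' heq => ?_, fun j hj => ?_⟩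
  · have h1 := hpos j hj
    have h2 := hpos j' hj'
    exact h.owner_inj j hj j' hj' (by omega) (by simp only at heq; omega)
  · exact ⟨h.owner_mem j hj _ (hpos j hj), h.owner_adj j hj _ (hpos j hj)⟩

/-- If a column has no owner, then some price level `g` is not taken, and the columns with a price
below `g` have too few neighbors. -/
theorem not_exists_matching (h : Auction row col m n N R price owner lv ptr 0 cnt)
    (hcnt : cnt < n) : ¬ ∃ f : ℕ → ℕ, Set.InjOn f {j | j < n} ∧
      ∀ j < n, f j ∈ R ∧ ∃ e < N, row e = f j ∧ col e = j := by
  rintro ⟨f, hinj, hf⟩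
  obtain ⟨j₀, hj₀, h0⟩ : ∃ j < n, owner j = 0 := by
    by_contra hcon
    push Not at hcon
    rw [h.cnt_eq, filter_true_of_mem fun j hj => hcon j (mem_range.1 hj), card_range] at hcnt
    omega
  -- The free column has price zero, and the other `n - 1` columns cannot take all the values `1, …,
  -- n`.
  obtain ⟨g, hg1, hgn, hg⟩ : ∃ g, 1 ≤ g ∧ g ≤ n ∧ ∀ j < n, price j ≠ g := by
    by_contra hcon
    push Not at hcon
    have hsub : Icc 1 n ⊆ ((range n).erase j₀).image price := by
      intro g hg
      obtain ⟨hg1, hgn⟩ := mem_Icc.1 hg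
      obtain ⟨j, hj, hjg⟩ := hcon g hg1 hgn
      refine mem_image.2 ⟨j, mem_erase.2 ⟨?_, mem_range.2 hj⟩, hjg⟩
      rintro rfl
      have := (h.owner_eq_zero j hj).1 h0
      omega
    have h1 := (card_le_card hsub).trans card_image_le
    rw [card_erase_of_mem (mem_range.2 hj₀), card_range, Nat.card_Icc] at h1
    omega
  -- The row matched to `j` has level at most `price j < g ≤ n`. It has not given up and nobody is
  -- searching, so it owns a column, whose price is at most one above the level. That price is at
  -- most `g`, and the gap makes it smaller.
  have hnext : ∀ j, j < n → price j < g → ∃ j' < n, price j' < g ∧ owner j' = f j + 1 := by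
    intro j hj hjg
    obtain ⟨hfR, e, he, hrow, hcol⟩ := hf j hj
    rcases h.settled _ hfR with h' | ⟨j', hj', h'⟩ | h'
    · omega
    · refine ⟨j', hj', ?_, h'⟩
      have h1 := (h.owner_lv j' hj' _ h').1
      have h2 := h.le_price e he
      rw [hrow, hcol] at h2
      have h3 := hg j' hj'
      omega
    · have := h' e he hrow
      rw [hcol] at this
      omega
  choose! next hnext using hnext
  let J := (range n).filter fun j => price j < g
  have hJ : ∀ {j}, j ∈ J ↔ j < n ∧ price j < g := by simp [J]
  have hj₀J : j₀ ∈ J := hJ.2 ⟨hj₀, by have := (h.owner_eq_zero j₀ hj₀).1 h0; omega⟩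
  -- Sending `j` to the column owned by its partner maps `J` injectively into its owned columns,
  -- which exclude `j₀`: a contradiction.
  have hcard : J.card ≤ (J.erase j₀).card := by
    refine card_le_card_of_injOn next (fun j hj => ?_) fun j hj j' hj' heq => ?_
    · obtain ⟨hj1, hj2⟩ := hJ.1 hj
      obtain ⟨h1, h2, h3⟩ := hnext j hj1 hj2
      refine mem_erase.2 ⟨fun heq => ?_, hJ.2 ⟨h1, h2⟩⟩
      rw [heq] at h3
      omega
    · obtain ⟨hj1, hj2⟩ := hJ.1 hj
      obtain ⟨hj3, hj4⟩ := hJ.1 hj'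
      have h3 := (hnext j hj1 hj2).2.2
      have h4 := (hnext j' hj3 hj4).2.2
      rw [heq, h4] at h3
      exact hinj hj1 hj3 (by omega)
  rw [card_erase_of_mem hj₀J] at hcard
  have := card_pos.2 ⟨j₀, hj₀J⟩
  omega

end Auction

/-! ### The program -/

notation "rM" => 0
notation "rN" => 1
notation "rE" => 2
notation "rZero" => 3
notation "rOne" => 4
notation "rEdge" => 5
notation "rRow" => 6
notation "rTmp" => 7
notation "rV" => 8
notation "rBest" => 9
notation "rI" => 10
notation "rCur" => 11
notation "rC" => 12
notation "rPtr" => 13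
notation "rLv" => 14
notation "rCol" => 15
notation "rPrice" => 16
notation "rOwner" => 17
notation "rCnt" => 18
notation "rSize" => 19
notation "rLen" => 20
notation "aRow" => 0
notation "aCol" => 1
notation "aHead" => 2
notation "aNext" => 3
notation "aPtr" => 4
notation "aLv" => 5
notation "aPrice" => 6
notation "aOwner" => 7
notation "aMark" => 8
notation "aIn" => 9
notation "aBest" => 10

namespace Cmd

/-- Link the edge `rEdge` into the list of the edges of its row. -/
def linkEdge : Cmd := block
  [load rRow aRow rEdge, load rTmp aHead rRow, store aNext rEdge rTmp, copy rTmp rEdge, inc rTmp,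
    store aHead rRow rTmp, inc rEdge]

/-- The row `rCur - 1` scans its next edge. -/
def auctionStep : Cmd := block
  [copy rC rCur, dec rC, load rPtr aPtr rC, load rLv aLv rC,
    ifLt rZero rPtr
      (block
        [dec rPtr, load rTmp aNext rPtr, store aPtr rC rTmp, load rCol aCol rPtr,
          load rPrice aPrice rCol,
          ifLt rLv rPrice skip
            (block
              [inc rLv, store aPrice rCol rLv, load rOwner aOwner rCol, store aOwner rCol rCur,
                copy rCur rOwner, ifLt rZero rOwner skip (inc rCnt)])])
      (block
        [inc rLv, store aLv rC rLv, load rTmp aHead rC, store aPtr rC rTmp,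
          ifLt rLv rN skip (const rCur 0)])]

/-- Let the row `rI` look for a column, unless it has no edges. -/
def activateRow : Cmd := block
  [copy rCur rI, inc rCur, load rTmp aHead rI, ifLt rZero rTmp skip (const rCur 0)]

/-- Insert the row `rI` into the auction. -/
def insertRow : Cmd := seq activateRow (whileLt rZero rCur auctionStep)

/-- Insert the row `rI` into the auction, and keep it if the rows do not match all columns. -/
def addRow : Cmd := seq insertRow
  (ifLt rCnt rN (block [inc rSize, store aIn rI rOne]) skip)

end Cmd

/-! ### The auction inside the machine -/

section Env

variable {m n : ℕ}

/-- The row of the `e`-th position in the list. -/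
def rowOf (L : List (Fin m × Fin n)) (e : ℕ) : ℕ := (L.map fun e => (e.1 : ℕ)).getD e 0

/-- The column of the `e`-th position in the list. -/
def colOf (L : List (Fin m × Fin n)) (e : ℕ) : ℕ := (L.map fun e => (e.2 : ℕ)).getD e 0

variable {L : List (Fin m × Fin n)}

theorem rowOf_eq {e : ℕ} (he : e < L.length) : rowOf L e = (L[e].1 : ℕ) := by
  simp [rowOf, he]

theorem colOf_eq {e : ℕ} (he : e < L.length) : colOf L e = (L[e].2 : ℕ) := by
  simp [colOf, he]

theorem rowOf_lt {e : ℕ} (he : e < L.length) : rowOf L e < m := by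
  rw [rowOf_eq he]; exact L[e].1.2

theorem colOf_lt {e : ℕ} (he : e < L.length) : colOf L e < n := by
  rw [colOf_eq he]; exact L[e].2.2

theorem mem_iff_exists_edge {i : Fin m} {j : Fin n} :
    (i, j) ∈ L.toFinset ↔ ∃ e < L.length, rowOf L e = i ∧ colOf L e = j := by
  rw [List.mem_toFinset, List.mem_iff_getElem]
  constructor
  · rintro ⟨e, he, h⟩
    exact ⟨e, he, by rw [rowOf_eq he, h], by rw [colOf_eq he, h]⟩
  · rintro ⟨e, he, h1, h2⟩
    rw [rowOf_eq he] at h1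
    rw [colOf_eq he] at h2
    exact ⟨e, he, Prod.ext (Fin.ext h1) (Fin.ext h2)⟩

/-- The input, the constants and the lists of edges are in place. -/
structure Env (L : List (Fin m × Fin n)) (s : Store) : Prop where
  m_eq : s.reg rM = m
  n_eq : s.reg rN = n
  len_eq : s.reg rE = L.length
  zero_eq : s.reg rZero = 0
  one_eq : s.reg rOne = 1
  row_eq : s.arr aRow = rowOf L
  col_eq : s.arr aCol = colOf L
  head_eq : ∀ i < m, s.arr aHead i = prevEdge (rowOf L) i L.length
  next_eq : ∀ e < L.length, s.arr aNext e = prevEdge (rowOf L) (rowOf L e) e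

/-- The command preserves `Env`. -/
def Cmd.keepsEnv (c : Cmd) : Bool :=
  (c.keepsReg rM && c.keepsReg rN && c.keepsReg rE && c.keepsReg rZero && c.keepsReg rOne) &&
    (c.keepsArr aRow && c.keepsArr aCol && c.keepsArr aHead && c.keepsArr aNext)

theorem Env.frame {c : Cmd} {s s' : Store} (h : Env L s) (hf : c.Frame s s')
    (hc : c.keepsEnv = true) : Env L s' := by
  simp only [Cmd.keepsEnv, Bool.and_eq_true] at hc
  obtain ⟨⟨⟨⟨⟨h0, h1⟩, h2⟩, h3⟩, h4⟩, ⟨⟨a0, a1⟩, a2⟩, a3⟩ := hc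
  constructor
  · rw [hf.reg _ h0, h.m_eq]
  · rw [hf.reg _ h1, h.n_eq]
  · rw [hf.reg _ h2, h.len_eq]
  · rw [hf.reg _ h3, h.zero_eq]
  · rw [hf.reg _ h4, h.one_eq]
  · rw [hf.arr _ a0, h.row_eq]
  · rw [hf.arr _ a1, h.col_eq]
  · rw [hf.arr _ a2]; exact h.head_eq
  · rw [hf.arr _ a3]; exact h.next_eq

/-- The auction on the rows `T`, as stored in the machine. -/
def StoredAuction (L : List (Fin m × Fin n)) (T : Finset (Fin m)) (s : Store) : Prop :=
  Auction (rowOf L) (colOf L) m n L.length (T.map Fin.valEmbedding) (s.arr aPrice) (s.arr aOwner)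
    (s.arr aLv) (s.arr aPtr) (s.reg rCur) (s.reg rCnt)

/-- At rest, comparing one counter with `n` decides the rank test of the inner loop. -/
theorem StoredAuction.matchable_iff {T : Finset (Fin m)} {s : Store} (h : StoredAuction L T s)
    (hcur : s.reg rCur = 0) : Matchable L.toFinset T ↔ s.reg rCnt = n := by
  constructor
  · rintro ⟨f, hf, hfT⟩
    by_contra hne
    rw [StoredAuction, hcur] at h
    refine h.not_exists_matching (lt_of_le_of_ne h.cnt_le hne)
      ⟨fun j => if hj : j < n then f ⟨j, hj⟩ else 0, fun j hj j' hj' heq => ?_, fun j hj => ?_⟩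
    · simp only [Set.mem_ofPred_eq] at hj hj'
      simp only [dif_pos hj, dif_pos hj'] at heq
      exact congrArg Fin.val (hf (Fin.ext heq))
    · simp only [dif_pos hj]
      exact ⟨mem_map_of_mem _ (hfT _).1, mem_iff_exists_edge.1 (hfT ⟨j, hj⟩).2⟩
  · intro hcnt
    obtain ⟨f, hinj, hf⟩ := h.exists_matching hcnt
    have hex : ∀ j : Fin n, ∃ i ∈ T, (i : ℕ) = f j := fun j => by
      simpa using (hf j j.2).1
    choose g hgT hg using hex
    refine ⟨g, fun j j' heq => Fin.ext (hinj j.2 j'.2 ?_), fun j => ⟨hgT j, ?_⟩⟩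
    · rw [← hg, ← hg, heq]
    · obtain ⟨e, he, h1, h2⟩ := (hf j j.2).2
      exact mem_iff_exists_edge.2 ⟨e, he, by rw [h1, hg], h2⟩

/-- The potential of the stored auction. -/
def storedPotential (L : List (Fin m × Fin n)) (s : Store) : ℕ :=
  (Cmd.auctionStep.cost + 1) * potential (rowOf L) m n L.length (s.arr aLv) (s.arr aPtr)

theorem storedPotential_congr {s s' : Store} (h : s'.arr aLv = s.arr aLv)
    (h' : s'.arr aPtr = s.arr aPtr) : storedPotential L s' = storedPotential L s := by
  rw [storedPotential, storedPotential, h, h']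

/-- The branches of the command are exactly the transitions `raise_level`, `skip_edge` and `bid` of
the abstract auction. Each one scans an edge or raises a level, hence lowers the potential. -/
theorem auctionStep_spec {T : Finset (Fin m)} {s : Store} (hE : Env L s)
    (h : StoredAuction L T s) (hcur : s.reg rZero < s.reg rCur) :
    StoredAuction L T (Cmd.auctionStep.eval s) ∧
      potential (rowOf L) m n L.length ((Cmd.auctionStep.eval s).arr aLv)
        ((Cmd.auctionStep.eval s).arr aPtr) <
      potential (rowOf L) m n L.length (s.arr aLv) (s.arr aPtr) := by
  have hz := hE.zero_eq
  obtain ⟨c, hc⟩ : ∃ c, s.reg rCur = c + 1 := ⟨s.reg rCur - 1, by omega⟩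
  have hA := h
  rw [StoredAuction, hc] at hA
  have hcm := hA.cur_lt
  rcases hq : s.arr aPtr c with _ | q
  -- Raising the level releases twice the degree of the row, and resetting the pointer takes the
  -- degree back once; this explains the factor two in `rowPotential`. The degree is positive
  -- because a searching row has an edge.
  · have hev : potential (rowOf L) m n L.length (Function.update (s.arr aLv) c (s.arr aLv c + 1))
        (Function.update (s.arr aPtr) c (prevEdge (rowOf L) c L.length)) <
        potential (rowOf L) m n L.length (s.arr aLv) (s.arr aPtr) := by
      refine potential_lt hcm (fun i hi => ?_) ?_
      · rw [Function.update_of_ne hi, Function.update_of_ne hi]; exact ⟨rfl, rfl⟩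
      · obtain ⟨e, he, hec⟩ := hA.cur_adj c rfl
        have hpos : 0 < Nat.count (fun f => rowOf L f = c) L.length := by
          have := Nat.count_monotone (fun f => rowOf L f = c) (Nat.succ_le_of_lt he)
          rw [Nat.succ_eq_add_one, Nat.count_succ, if_pos hec] at this
          omega
        obtain ⟨d, hd⟩ : ∃ d, n - s.arr aLv c = d + 1 :=
          ⟨n - s.arr aLv c - 1, by have := hA.cur_lv c rfl; omega⟩
        rw [Function.update_self, Function.update_self, rowPotential, rowPotential, hq,
          count_prevEdge, hd, show n - (s.arr aLv c + 1) = d by omega, Nat.count_zero]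
        nlinarith
    have hA' := hA.raise_level hq
    by_cases hn : s.arr aLv c + 1 < n
    · rw [if_pos hn] at hA'
      refine ⟨?_, ?_⟩
      · simpa [StoredAuction, Cmd.auctionStep, Cmd.block, Cmd.eval, hc, hq, hz, hn, hE.n_eq,
          hE.head_eq c hcm] using hA'
      · simpa [Cmd.auctionStep, Cmd.block, Cmd.eval, hc, hq, hz, hn, hE.n_eq,
          hE.head_eq c hcm] using hev
    · rw [if_neg hn] at hA'
      refine ⟨?_, ?_⟩
      · simpa [StoredAuction, Cmd.auctionStep, Cmd.block, Cmd.eval, hc, hq, hz, hn, hE.n_eq,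
          hE.head_eq c hcm] using hA'
      · simpa [Cmd.auctionStep, Cmd.block, Cmd.eval, hc, hq, hz, hn, hE.n_eq,
          hE.head_eq c hcm] using hev
  · obtain ⟨hqN, hqc⟩ := hA.ptr_row c hcm q hq
    have hev : potential (rowOf L) m n L.length (s.arr aLv)
        (Function.update (s.arr aPtr) c (prevEdge (rowOf L) c q)) <
        potential (rowOf L) m n L.length (s.arr aLv) (s.arr aPtr) := by
      refine potential_lt hcm (fun i hi => ?_) ?_
      · rw [Function.update_of_ne hi]; exact ⟨rfl, rfl⟩
      · rw [Function.update_self, rowPotential, rowPotential, hq, count_prevEdge,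
          Nat.count_succ, if_pos hqc]
        omega
    have hnext := hE.next_eq q hqN
    rw [hqc] at hnext
    by_cases hp : s.arr aLv c < s.arr aPrice (colOf L q)
    · have hA' := hA.skip_edge hq hp
      refine ⟨?_, ?_⟩
      · simpa [StoredAuction, Cmd.auctionStep, Cmd.block, Cmd.eval, hc, hq, hz, hp, hE.col_eq,
          hnext] using hA'
      · simpa [Cmd.auctionStep, Cmd.block, Cmd.eval, hc, hq, hz, hp, hE.col_eq,
          hnext] using hev
    · have hA' := hA.bid hq (not_lt.1 hp)
      by_cases ho : 0 < s.arr aOwner (colOf L q)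
      · rw [if_pos ho] at hA'
        refine ⟨?_, ?_⟩
        · simpa [StoredAuction, Cmd.auctionStep, Cmd.block, Cmd.eval, hc, hq, hz, hp, ho,
            hE.col_eq, hnext] using hA'
        · simpa [Cmd.auctionStep, Cmd.block, Cmd.eval, hc, hq, hz, hp, ho, hE.col_eq,
            hnext] using hev
      · rw [if_neg ho] at hA'
        refine ⟨?_, ?_⟩
        · simpa [StoredAuction, Cmd.auctionStep, Cmd.block, Cmd.eval, hc, hq, hz, hp, ho,
            hE.col_eq, hnext] using hA'
        · simpa [Cmd.auctionStep, Cmd.block, Cmd.eval, hc, hq, hz, hp, ho, hE.col_eq,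
            hnext] using hev

/-- The potential is scaled by the cost of an iteration including its test, so it pays for all
iterations; only the final failing test is charged. -/
theorem auction_loop {T : Finset (Fin m)} {s : Store} (hE : Env L s) (h : StoredAuction L T s) :
    Runs (storedPotential L) (Cmd.whileLt rZero rCur Cmd.auctionStep) s 1
      fun s' => StoredAuction L T s' ∧ s'.reg rCur = 0 := by
  refine (Runs.while_potential (fun s => Env L s ∧ StoredAuction L T s) ⟨hE, h⟩ ?_).mono le_rfl ?_
  · rintro s hlt ⟨hE, h⟩
    obtain ⟨h1, h2⟩ := auctionStep_spec hE h hlt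
    obtain ⟨k, hk, he⟩ := Cmd.exec_eval (c := Cmd.auctionStep) rfl s
    refine ⟨k, _, he, ?_, hE.frame he.frame rfl, h1⟩
    have := Nat.mul_le_mul_left (Cmd.auctionStep.cost + 1) (Nat.succ_le_of_lt h2)
    rw [Nat.mul_succ] at this
    rw [storedPotential, storedPotential]
    omega
  · rintro s' - ⟨⟨hE, h⟩, hlt⟩
    have := hE.zero_eq
    exact ⟨h, by omega⟩

theorem insertRow_spec (hn : 0 < n) {T : Finset (Fin m)} {s : Store} (hE : Env L s)
    (h : StoredAuction L T s) (hcur : s.reg rCur = 0) {i : Fin m} (hi : s.reg rI = i)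
    (hiT : i ∉ T) :
    Runs (storedPotential L) Cmd.insertRow s (Cmd.activateRow.cost + 1)
      fun s' => StoredAuction L (insert i T) s' ∧ s'.reg rCur = 0 := by
  refine Runs.seq (R := StoredAuction L (insert i T)) (Runs.of_eval rfl ?_ ?_)
    fun s' hf h' => auction_loop (hE.frame hf rfl) h'
  · rw [storedPotential_congr (s := s)]
    · omega
    · by_cases h0 : s.reg rZero < s.arr aHead i <;>
        simp [Cmd.activateRow, Cmd.block, Cmd.eval, hi, h0]
    · by_cases h0 : s.reg rZero < s.arr aHead i <;>
        simp [Cmd.activateRow, Cmd.block, Cmd.eval, hi, h0]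
  · have hz := hE.zero_eq
    have hhead := hE.head_eq i i.2
    have hiT' : (i : ℕ) ∉ T.map Fin.valEmbedding :=
      (mem_map' Fin.valEmbedding).not.2 hiT
    rw [StoredAuction, hcur] at h
    by_cases hdeg : ∃ e < L.length, rowOf L e = i
    · obtain ⟨e, he, hei⟩ := hdeg
      have hpos : 0 < prevEdge (rowOf L) i L.length := by
        have := lt_prevEdge he hei; omega
      simpa [StoredAuction, Cmd.activateRow, Cmd.block, Cmd.eval, hi, hz, hhead, hpos, map_insert]
        using h.insert_row hn hiT' ⟨e, he, hei⟩
    · have hpos : prevEdge (rowOf L) i L.length = 0 := by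
        by_contra hne
        obtain ⟨q, hq⟩ := Nat.exists_eq_succ_of_ne_zero hne
        have := prevEdge_le (row := rowOf L) (i := i) L.length
        exact hdeg ⟨q, by omega, row_of_prevEdge hq⟩
      push Not at hdeg
      simpa [StoredAuction, Cmd.activateRow, Cmd.block, Cmd.eval, hi, hz, hhead, hpos, map_insert]
        using h.insert_isolated hdeg

/-- The auction on the rows `T` is at rest, and the rows `D` have been kept. -/
structure Progress (L : List (Fin m × Fin n)) (T D : Finset (Fin m)) (s : Store) : Prop where
  auction : StoredAuction L T s
  cur_eq : s.reg rCur = 0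
  size_eq : s.reg rSize = D.card
  mem_iff : ∀ i : Fin m, s.arr aIn i = if i ∈ D then 1 else 0

theorem Progress.frame {c : Cmd} {T D : Finset (Fin m)} {s s' : Store} (h : Progress L T D s)
    (hf : c.Frame s s') (hc : (c.keepsReg rCur && c.keepsReg rCnt && c.keepsReg rSize &&
      (c.keepsArr aPrice && c.keepsArr aOwner && c.keepsArr aLv && c.keepsArr aPtr &&
        c.keepsArr aIn)) = true) : Progress L T D s' := by
  simp only [Bool.and_eq_true] at hc
  obtain ⟨⟨⟨h1, h2⟩, h3⟩, ⟨⟨⟨a1, a2⟩, a3⟩, a4⟩, a5⟩ := hc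
  constructor
  · rw [StoredAuction, hf.arr _ a1, hf.arr _ a2, hf.arr _ a3, hf.arr _ a4, hf.reg _ h1,
      hf.reg _ h2]
    exact h.auction
  · rw [hf.reg _ h1, h.cur_eq]
  · rw [hf.reg _ h3, h.size_eq]
  · rw [hf.arr _ a5]; exact h.mem_iff

/-- The row stays in the auction in any case, but joins `D` only if the rows remain unmatchable. The
constant amortized cost holds because the evictions it triggers are paid by the potential. -/
theorem addRow_spec (hn : 0 < n) {T D : Finset (Fin m)} {s : Store} (hE : Env L s)
    (h : Progress L T D s) {i : Fin m} (hi : s.reg rI = i) (hiT : i ∉ T) (hiD : i ∉ D) :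
    Runs (storedPotential L) Cmd.addRow s 20 fun s' =>
      (Matchable L.toFinset (insert i T) → Progress L (insert i T) D s') ∧
      (¬ Matchable L.toFinset (insert i T) → Progress L (insert i T) (insert i D) s') := by
  refine (Runs.seq (insertRow_spec hn hE h.auction h.cur_eq hi hiT) fun s' hf h' => ?_).mono
    -- The final conditional costs at most `5`.
    (show _ + 5 ≤ 20 by decide) fun _ _ h => h
  obtain ⟨hA, hcur⟩ := h'
  have hE' := hE.frame hf rfl
  have hm := hA.matchable_iff hcur
  have hi' : s'.reg rI = i := (hf.reg _ rfl).trans hi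
  have hsize : s'.reg rSize = D.card := (hf.reg _ rfl).trans h.size_eq
  have hmem : ∀ i : Fin m, s'.arr aIn i = if i ∈ D then 1 else 0 := by
    rw [hf.arr _ rfl]; exact h.mem_iff
  have hcnt := hA.cnt_le
  have hn' := hE'.n_eq
  by_cases hlt : s'.reg rCnt < s'.reg rN
  · refine Runs.of_eval rfl ?_ ⟨fun hM => ?_, fun _ => ?_⟩
    · rw [storedPotential_congr (s := s') (by simp [Cmd.block, Cmd.eval, hlt])
        (by simp [Cmd.block, Cmd.eval, hlt]), add_comm]
      exact Nat.add_le_add_right (by decide) _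
    · rw [hm] at hM; omega
    · have hone := hE'.one_eq
      constructor
      · simpa [StoredAuction, Cmd.block, Cmd.eval, hlt] using hA
      · simpa [Cmd.block, Cmd.eval, hlt] using hcur
      · simp [Cmd.block, Cmd.eval, hlt, hsize, hiD]
      · intro j
        by_cases hj : j = i
        · subst hj; simp [Cmd.block, Cmd.eval, hlt, hi', hone]
        · have hj' : (j : ℕ) ≠ i := fun h => hj (Fin.ext h)
          simp [Cmd.block, Cmd.eval, hlt, hi', hj, hj', hmem]
  · refine Runs.of_eval rfl ?_ ⟨fun _ => ?_, fun hM => ?_⟩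
    · rw [storedPotential_congr (s := s') (by simp [Cmd.eval, hlt]) (by simp [Cmd.eval, hlt]),
        add_comm]
      exact Nat.add_le_add_right (by decide) _
    · rw [Cmd.eval, if_neg hlt]
      exact ⟨hA, hcur, hsize, hmem⟩
    · exact absurd (hm.2 (by omega)) hM

end Env

theorem Cmd.frame_eval {c : Cmd} (hc : c.loopFree = true) (s : Store) : c.Frame s (c.eval s) := by
  obtain ⟨k, -, h⟩ := Cmd.exec_eval hc s
  exact h.frame

/-- Running a command without loops, with potential zero. -/
theorem Runs.eval_zero {c : Cmd} (hc : c.loopFree = true) {s : Store} {Q : Store → Prop}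
    (hQ : Q (c.eval s)) : Runs (fun _ => 0) c s c.cost Q :=
  Runs.of_eval hc (by simp) hQ

/-! ### Subroutines and the complete program -/

namespace Cmd

/-- Prepare the row `rI` for a new auction. -/
def resetRow : Cmd := block
  [load rTmp aHead rI, store aPtr rI rTmp, store aLv rI rZero, store aMark rI rZero,
    store aIn rI rZero, inc rI]

def resetRows : Cmd := seq (const rI 0) (whileLt rI rM resetRow)

/-- Prepare the column `rI` for a new auction. -/
def resetCol : Cmd := block [store aPrice rI rZero, store aOwner rI rZero, inc rI]

def resetCols : Cmd := seq (const rI 0) (whileLt rI rN resetCol)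

/-- Mark the row of the edge `rEdge` if its column is `rV`. -/
def markEdge : Cmd := block
  [load rCol aCol rEdge,
    ifLt rCol rV skip
      (ifLt rV rCol skip (block [load rRow aRow rEdge, store aMark rRow rOne])),
    inc rEdge]

def markRows : Cmd := seq (const rEdge 0) (whileLt rEdge rE markEdge)

/-- Copy the membership of the row `rI` in the set just computed. -/
def copyRow : Cmd := block [load rTmp aIn rI, store aBest rI rTmp, inc rI]

def copyRows : Cmd := seq (const rI 0) (whileLt rI rM copyRow)

/-- Insert the row `rI` if it is not marked. -/
def firstRow : Cmd := seq (load rTmp aMark rI) (seq (ifLt rZero rTmp skip addRow) (inc rI))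

def firstRows : Cmd := seq (const rI 0) (whileLt rI rM firstRow)

/-- Choose the row `rI` if it is marked and the inner loop has not ended. -/
def chooseRow : Cmd := seq (load rTmp aMark rI)
  (seq (ifLt rZero rTmp (ifLt rCnt rN (seq (emit 1 rI) addRow) skip) skip) (inc rI))

def chooseRows : Cmd := seq (const rI 0) (whileLt rI rM chooseRow)

def clearCounters : Cmd := block [const rCur 0, const rCnt 0, const rSize 0]

def startRound : Cmd := seq (emit 0 rV) (seq resetRows (seq resetCols (seq markRows clearCounters)))

def endRound : Cmd := seq (ifLt rBest rSize (seq (copy rBest rSize) copyRows) skip) (inc rV)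

/-- The iteration of the outer loop for the column `rV`. -/
def round : Cmd := seq startRound (seq firstRows (seq chooseRows endRound))

/-- Output the row `rI` if it belongs to the returned set. -/
def outputRow : Cmd := block
  [load rTmp aBest rI, ifLt rZero rTmp (block [emit 2 rI, dec rM]) skip, inc rI]

def output : Cmd := seq (block [copy rLen rM, const rI 0]) (whileLt rI rLen outputRow)

def linkEdges : Cmd := seq (const rOne 1) (whileLt rEdge rE linkEdge)

def program : Cmd := seq linkEdges (seq (whileLt rV rN round) output)

end Cmd

/-! ### Preprocessing and the start of a round -/

section

variable {m n : ℕ} {L : List (Fin m × Fin n)}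

theorem linkEdges_spec :
    Runs (fun _ => 0) Cmd.linkEdges (inputStore L) (1 + (L.length * (Cmd.linkEdge.cost + 1) + 1))
      (Env L) := by
  refine Runs.seq (R := fun s => s = (Cmd.const rOne 1).eval (inputStore L))
    (Runs.eval_zero rfl rfl) ?_
  rintro _ - rfl
  -- After `t` edges, the head for a row is one more than its last edge before `t`, which is just
  -- the link that edge `t` needs. Arrays start at zero, which marks the end of a list.
  let Inv : ℕ → Store → Prop := fun t s =>
    (s.reg rM = m ∧ s.reg rN = n ∧ s.reg rZero = 0 ∧ s.reg rOne = 1 ∧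
      s.arr aRow = rowOf L ∧ s.arr aCol = colOf L) ∧ s.reg rE = L.length ∧
    (∀ i, s.arr aHead i = prevEdge (rowOf L) i t) ∧
    ∀ e < t, s.arr aNext e = prevEdge (rowOf L) (rowOf L e) e
  refine (Runs.counter (B := L.length) Inv ?_ ?_ ?_ ?_).mono le_rfl ?_
  · simp [Cmd.eval, inputStore]
  · simp [Cmd.eval, inputStore]
  · refine ⟨?_, ?_, ?_, ?_⟩
    · simp only [Cmd.eval, inputStore, Store.setReg_reg, Store.setReg_arr]
      exact ⟨rfl, rfl, rfl, rfl, rfl, rfl⟩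
    · simp [Cmd.eval, inputStore]
    · simp [Cmd.eval, inputStore, prevEdge]
    · simp
  · rintro t s ht hi hb ⟨⟨h0, h1, h2, h3, h4, h5⟩, h6, h7, h8⟩
    refine Runs.eval_zero rfl ⟨?_, ?_, ⟨?_, ?_, ?_, ?_, ?_, ?_⟩, ?_, ?_, ?_⟩
    · simp [Cmd.linkEdge, Cmd.block, Cmd.eval, hi]
    · simp [Cmd.linkEdge, Cmd.block, Cmd.eval, hb]
    · simp [Cmd.linkEdge, Cmd.block, Cmd.eval, h0]
    · simp [Cmd.linkEdge, Cmd.block, Cmd.eval, h1]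
    · simp [Cmd.linkEdge, Cmd.block, Cmd.eval, h2]
    · simp [Cmd.linkEdge, Cmd.block, Cmd.eval, h3]
    · simp [Cmd.linkEdge, Cmd.block, Cmd.eval, h4]
    · simp [Cmd.linkEdge, Cmd.block, Cmd.eval, h5]
    · simp [Cmd.linkEdge, Cmd.block, Cmd.eval, h6]
    · intro i
      simp only [Cmd.linkEdge, Cmd.block, Cmd.eval, prevEdge]
      by_cases hit : rowOf L t = i
      · simp [hi, h4, hit]
      · have hit' : i ≠ rowOf L t := fun h => hit h.symm
        simp [hi, h4, hit, hit', h7]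
    · intro e he
      by_cases het : e = t
      · subst het
        simp [Cmd.linkEdge, Cmd.block, Cmd.eval, hi, h4, h7]
      · simp [Cmd.linkEdge, Cmd.block, Cmd.eval, hi, het, h8 e (by omega)]
  · rintro s' - ⟨⟨h0, h1, h2, h3, h4, h5⟩, h6, h7, h8⟩
    exact ⟨h0, h1, h6, h2, h3, h4, h5, fun i _ => h7 i, h8⟩

theorem resetRows_spec {s : Store} (hE : Env L s) :
    Runs (fun _ => 0) Cmd.resetRows s (1 + (m * (Cmd.resetRow.cost + 1) + 1)) fun s' =>
      ∀ i < m, s'.arr aPtr i = prevEdge (rowOf L) i L.length ∧ s'.arr aLv i = 0 ∧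
        s'.arr aMark i = 0 ∧ s'.arr aIn i = 0 := by
  refine Runs.seq (R := fun s' => s'.reg rI = 0) (Runs.eval_zero rfl (by simp [Cmd.eval])) ?_
  intro s' hf h0
  have hE' := hE.frame hf rfl
  refine (Runs.counter (B := m) (fun t s => Env L s ∧
      ∀ i < t, s.arr aPtr i = prevEdge (rowOf L) i L.length ∧ s.arr aLv i = 0 ∧
        s.arr aMark i = 0 ∧ s.arr aIn i = 0) h0 hE'.m_eq ⟨hE', by simp⟩ ?_).mono le_rfl
    fun _ _ h => h.2
  rintro t s ht hi hb ⟨hE, h⟩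
  have hz := hE.zero_eq
  have hh := hE.head_eq t ht
  refine Runs.eval_zero rfl ⟨?_, ?_, hE.frame (Cmd.frame_eval rfl s) rfl, fun i hit => ?_⟩
  · simp [Cmd.resetRow, Cmd.block, Cmd.eval, hi]
  · simp [Cmd.resetRow, Cmd.block, Cmd.eval, hb]
  · by_cases hit' : i = t
    · subst hit'
      simp [Cmd.resetRow, Cmd.block, Cmd.eval, hi, hz, hh]
    · simp [Cmd.resetRow, Cmd.block, Cmd.eval, hi, hit', h i (by omega)]

theorem resetCols_spec {s : Store} (hE : Env L s) :
    Runs (fun _ => 0) Cmd.resetCols s (1 + (n * (Cmd.resetCol.cost + 1) + 1)) fun s' =>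
      ∀ j < n, s'.arr aPrice j = 0 ∧ s'.arr aOwner j = 0 := by
  refine Runs.seq (R := fun s' => s'.reg rI = 0) (Runs.eval_zero rfl (by simp [Cmd.eval])) ?_
  intro s' hf h0
  have hE' := hE.frame hf rfl
  refine (Runs.counter (B := n) (fun t s => Env L s ∧
      ∀ j < t, s.arr aPrice j = 0 ∧ s.arr aOwner j = 0) h0 hE'.n_eq ⟨hE', by simp⟩ ?_).mono le_rfl
    fun _ _ h => h.2
  rintro t s ht hi hb ⟨hE, h⟩
  have hz := hE.zero_eq
  refine Runs.eval_zero rfl ⟨?_, ?_, hE.frame (Cmd.frame_eval rfl s) rfl, fun j hjt => ?_⟩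
  · simp [Cmd.resetCol, Cmd.block, Cmd.eval, hi]
  · simp [Cmd.resetCol, Cmd.block, Cmd.eval, hb]
  · by_cases hjt' : j = t
    · subst hjt'
      simp [Cmd.resetCol, Cmd.block, Cmd.eval, hi, hz]
    · simp [Cmd.resetCol, Cmd.block, Cmd.eval, hi, hjt', h j (by omega)]

/-- The marked rows are those adjacent to the column `v`. -/
def Marked (L : List (Fin m × Fin n)) (v : Fin n) (s : Store) : Prop :=
  ∀ i : Fin m, 0 < s.arr aMark i ↔ (i, v) ∈ L.toFinset

theorem markRows_spec {s : Store} {v : Fin n} (hE : Env L s) (hv : s.reg rV = v)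
    (hmark : ∀ i < m, s.arr aMark i = 0) :
    Runs (fun _ => 0) Cmd.markRows s (1 + (L.length * (Cmd.markEdge.cost + 1) + 1))
      (Marked L v) := by
  refine Runs.seq (R := fun s' => s'.reg rEdge = 0) (Runs.eval_zero rfl (by simp [Cmd.eval])) ?_
  intro s' hf h0
  have hE' := hE.frame hf rfl
  have hv' : s'.reg rV = v := (hf.reg _ rfl).trans hv
  refine (Runs.counter (B := L.length) (fun t s => Env L s ∧ s.reg rV = v ∧
      ∀ i < m, 0 < s.arr aMark i ↔ ∃ e < t, rowOf L e = i ∧ colOf L e = v) h0 hE'.len_eq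
      ⟨hE', hv', fun i hi => by rw [hf.arr _ rfl, hmark i hi]; simp⟩ ?_).mono le_rfl
    fun _ _ h i => (h.2.2 i i.2).trans mem_iff_exists_edge.symm
  rintro t s ht hi hb ⟨hE, hv, h⟩
  have hone := hE.one_eq
  have hE' := hE.frame (Cmd.frame_eval (c := Cmd.markEdge) rfl s) rfl
  have hstep : ∀ i, (∃ e < t + 1, rowOf L e = i ∧ colOf L e = v) ↔
      (∃ e < t, rowOf L e = i ∧ colOf L e = v) ∨ rowOf L t = i ∧ colOf L t = v := by
    intro i
    constructor
    · rintro ⟨e, he, h1⟩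
      rcases Nat.lt_succ_iff_lt_or_eq.1 he with he | rfl
      · exact Or.inl ⟨e, he, h1⟩
      · exact Or.inr h1
    · rintro (⟨e, he, h1⟩ | h1)
      · exact ⟨e, by omega, h1⟩
      · exact ⟨t, by omega, h1⟩
  -- The machine tests equality of columns by two strict comparisons.
  rcases lt_trichotomy (colOf L t) v with hlt | heq | hgt
  · refine Runs.eval_zero rfl ⟨?_, ?_, hE', ?_, fun i hm => ?_⟩
    · simp [Cmd.markEdge, Cmd.block, Cmd.eval, hi, hE.col_eq, hv, hlt]
    · simp [Cmd.markEdge, Cmd.block, Cmd.eval, hi, hE.col_eq, hv, hlt, hb]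
    · simp [Cmd.markEdge, Cmd.block, Cmd.eval, hi, hE.col_eq, hv, hlt]
    · rw [hstep, ← h i hm]
      simp [Cmd.markEdge, Cmd.block, Cmd.eval, hi, hE.col_eq, hv, hlt, hlt.ne]
  · refine Runs.eval_zero rfl ⟨?_, ?_, hE', ?_, fun i hm => ?_⟩
    · simp [Cmd.markEdge, Cmd.block, Cmd.eval, hi, hE.col_eq, hv, heq]
    · simp [Cmd.markEdge, Cmd.block, Cmd.eval, hi, hE.col_eq, hv, heq, hb]
    · simp [Cmd.markEdge, Cmd.block, Cmd.eval, hi, hE.col_eq, hv, heq]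
    · rw [hstep, ← h i hm]
      by_cases hit : rowOf L t = i
      · simp [Cmd.markEdge, Cmd.block, Cmd.eval, hi, hE.col_eq, hE.row_eq, hv, heq, hit, hone]
      · have hit' : i ≠ rowOf L t := fun h => hit h.symm
        simp [Cmd.markEdge, Cmd.block, Cmd.eval, hi, hE.col_eq, hE.row_eq, hv, heq, hit, hit']
  · have hlt := hgt.not_gt
    refine Runs.eval_zero rfl ⟨?_, ?_, hE', ?_, fun i hm => ?_⟩
    · simp [Cmd.markEdge, Cmd.block, Cmd.eval, hi, hE.col_eq, hv, hlt, hgt]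
    · simp [Cmd.markEdge, Cmd.block, Cmd.eval, hi, hE.col_eq, hv, hlt, hgt, hb]
    · simp [Cmd.markEdge, Cmd.block, Cmd.eval, hi, hE.col_eq, hv, hlt, hgt]
    · rw [hstep, ← h i hm]
      simp [Cmd.markEdge, Cmd.block, Cmd.eval, hi, hE.col_eq, hv, hlt, hgt, hgt.ne']

theorem copyRows_spec {s : Store} (hE : Env L s) :
    Runs (fun _ => 0) Cmd.copyRows s (1 + (m * (Cmd.copyRow.cost + 1) + 1)) fun s' =>
      ∀ i < m, s'.arr aBest i = s.arr aIn i := by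
  refine Runs.seq (R := fun s' => s'.reg rI = 0) (Runs.eval_zero rfl (by simp [Cmd.eval])) ?_
  intro s' hf h0
  have hE' := hE.frame hf rfl
  refine (Runs.counter (B := m) (fun t s' => s'.arr aIn = s.arr aIn ∧
      ∀ i < t, s'.arr aBest i = s.arr aIn i) h0 hE'.m_eq ⟨hf.arr _ rfl, by simp⟩ ?_).mono le_rfl
    fun _ _ h => h.2
  rintro t s' ht hi hb ⟨hin, h⟩
  refine Runs.eval_zero rfl ⟨?_, ?_, ?_, fun i hit => ?_⟩
  · simp [Cmd.copyRow, Cmd.block, Cmd.eval, hi]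
  · simp [Cmd.copyRow, Cmd.block, Cmd.eval, hb]
  · simp [Cmd.copyRow, Cmd.block, Cmd.eval, hin]
  · by_cases hit' : i = t
    · subst hit'
      simp [Cmd.copyRow, Cmd.block, Cmd.eval, hi, hin]
    · simp [Cmd.copyRow, Cmd.block, Cmd.eval, hi, hit', h i (by omega)]

/-- The state of the machine during the round for the column `v`. -/
structure RoundState (L : List (Fin m × Fin n)) (v : Fin n) (T D : Finset (Fin m))
    (s : Store) : Prop extends Env L s, Progress L T D s where
  v_eq : s.reg rV = v
  marked : Marked L v s

theorem RoundState.frame {c : Cmd} {v : Fin n} {T D : Finset (Fin m)} {s s' : Store}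
    (h : RoundState L v T D s) (hf : c.Frame s s') (h1 : c.keepsEnv = true)
    (h2 : (c.keepsReg rCur && c.keepsReg rCnt && c.keepsReg rSize &&
      (c.keepsArr aPrice && c.keepsArr aOwner && c.keepsArr aLv && c.keepsArr aPtr &&
        c.keepsArr aIn)) = true)
    (h3 : (c.keepsReg rV && c.keepsArr aMark) = true) : RoundState L v T D s' := by
  rw [Bool.and_eq_true] at h3
  refine ⟨h.toEnv.frame hf h1, h.toProgress.frame hf h2, ?_, ?_⟩
  · rw [hf.reg _ h3.1, h.v_eq]
  · rw [Marked, hf.arr _ h3.2]; exact h.marked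

theorem startRound_spec {s : Store} {v : Fin n} (hE : Env L s) (hv : s.reg rV = v) :
    Runs (fun _ => 0) Cmd.startRound s
      (1 + ((1 + (m * (Cmd.resetRow.cost + 1) + 1)) + ((1 + (n * (Cmd.resetCol.cost + 1) + 1)) +
        ((1 + (L.length * (Cmd.markEdge.cost + 1) + 1)) + Cmd.clearCounters.cost)))) fun s' =>
      RoundState L v ∅ ∅ s' ∧ s'.out = s.out ++ [(0, (v : ℕ))] ∧
        storedPotential L s' = (Cmd.auctionStep.cost + 1) * ((2 * n + 1) * L.length) := by
  refine Runs.seq (R := fun s' => s'.out = s.out ++ [(0, (v : ℕ))])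
    (Runs.eval_zero rfl (by simp [Cmd.eval, hv])) fun s₁ hf₁ hout₁ => ?_
  have hE₁ := hE.frame hf₁ rfl
  refine Runs.seq (resetRows_spec hE₁) fun s₂ hf₂ hrows => ?_
  have hE₂ := hE₁.frame hf₂ rfl
  refine Runs.seq (resetCols_spec hE₂) fun s₃ hf₃ hcols => ?_
  have hE₃ := hE₂.frame hf₃ rfl
  have hv₃ : s₃.reg rV = v := by rw [hf₃.reg _ rfl, hf₂.reg _ rfl, hf₁.reg _ rfl, hv]
  refine Runs.seq (markRows_spec hE₃ hv₃ fun i hi => ?_) fun s₄ hf₄ hmark => ?_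
  · rw [hf₃.arr _ rfl]
    exact (hrows i hi).2.2.1
  have hE₄ := hE₃.frame hf₄ rfl
  have hf₅ := Cmd.frame_eval (c := Cmd.clearCounters) rfl s₄
  have hptr : (Cmd.clearCounters.eval s₄).arr aPtr = s₂.arr aPtr := by
    rw [hf₅.arr _ rfl, hf₄.arr _ rfl, hf₃.arr _ rfl]
  have hlv : (Cmd.clearCounters.eval s₄).arr aLv = s₂.arr aLv := by
    rw [hf₅.arr _ rfl, hf₄.arr _ rfl, hf₃.arr _ rfl]
  have hin : (Cmd.clearCounters.eval s₄).arr aIn = s₂.arr aIn := by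
    rw [hf₅.arr _ rfl, hf₄.arr _ rfl, hf₃.arr _ rfl]
  have hprice : (Cmd.clearCounters.eval s₄).arr aPrice = s₃.arr aPrice := by
    rw [hf₅.arr _ rfl, hf₄.arr _ rfl]
  have howner : (Cmd.clearCounters.eval s₄).arr aOwner = s₃.arr aOwner := by
    rw [hf₅.arr _ rfl, hf₄.arr _ rfl]
  have hcur : (Cmd.clearCounters.eval s₄).reg rCur = 0 := by
    simp [Cmd.clearCounters, Cmd.block, Cmd.eval]
  have hcnt : (Cmd.clearCounters.eval s₄).reg rCnt = 0 := by
    simp [Cmd.clearCounters, Cmd.block, Cmd.eval]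
  refine Runs.eval_zero rfl ⟨⟨hE₄.frame hf₅ rfl, ⟨?_, hcur, ?_, ?_⟩, ?_, ?_⟩, ?_, ?_⟩
  · rw [StoredAuction, hptr, hlv, hprice, howner, hcur, hcnt, map_empty]
    exact Auction.init (fun e he => rowOf_lt he) (fun e he => colOf_lt he)
      (fun j hj => (hcols j hj).1) (fun j hj => (hcols j hj).2) (fun i hi => (hrows i hi).2.1)
      fun i hi => (hrows i hi).1
  · simp [Cmd.clearCounters, Cmd.block, Cmd.eval]
  · intro i
    rw [hin, (hrows i i.2).2.2.2]
    simp
  · rw [hf₅.reg _ rfl, hf₄.reg _ rfl, hv₃]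
  · rw [Marked, hf₅.arr _ rfl]
    exact hmark
  · rw [hf₅.out rfl, hf₄.out rfl, hf₃.out rfl, hf₂.out rfl, hout₁]
  -- Resetting levels and pointers restores the full potential, which is the budget of the round.
  · rw [storedPotential, hptr, hlv, potential_init (fun e he => rowOf_lt he)
      (fun i hi => (hrows i hi).2.1) fun i hi => (hrows i hi).1]

end

/-! ### One iteration of the outer loop -/

section

variable {m n : ℕ} {L : List (Fin m × Fin n)}

theorem firstRow_spec (hn : 0 < n) {v : Fin n} {i : Fin m} {T D : Finset (Fin m)} {s : Store}
    (h : RoundState L v T D s) (hi : s.reg rI = i) (hiT : i ∉ T) (hiD : i ∉ D)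
    (hM : (i, v) ∉ L.toFinset → ¬ Matchable L.toFinset (insert i T)) :
    Runs (storedPotential L) Cmd.firstRow s (1 + (20 + 1 + 1)) fun s' => s'.reg rI = i + 1 ∧
      ((i, v) ∈ L.toFinset → RoundState L v T D s') ∧
      ((i, v) ∉ L.toFinset → RoundState L v (insert i T) (insert i D) s') := by
  refine Runs.seq (R := fun s' => s'.reg rTmp = s.arr aMark i)
    (Runs.of_zero (Runs.eval_zero rfl rfl) (fun s' hf _ => ?_) fun s' _ h => ?_)
    fun s₁ hf₁ htmp => ?_
  · exact (storedPotential_congr (hf.arr _ rfl) (hf.arr _ rfl)).le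
  · subst h
    simp [Cmd.eval, hi]
  have h₁ := h.frame hf₁ rfl rfl rfl
  have hi₁ : s₁.reg rI = i := (hf₁.reg _ rfl).trans hi
  have hz := h₁.zero_eq
  have hmark := h.marked i
  refine Runs.seq (R := fun s' => s'.reg rI = i ∧
      ((i, v) ∈ L.toFinset → RoundState L v T D s') ∧
      ((i, v) ∉ L.toFinset → RoundState L v (insert i T) (insert i D) s'))
    (Runs.ifLt (fun hlt => ?_) fun hlt => ?_) fun s₂ hf₂ h₂ => ?_
  · have hmem : (i, v) ∈ L.toFinset := hmark.1 (by omega)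
    exact Runs.of_eval rfl (by simp only [Cmd.eval, Cmd.cost]; omega)
      ⟨hi₁, fun _ => h₁, fun h => absurd hmem h⟩
  · have hmem : (i, v) ∉ L.toFinset := fun hmem => hlt (by have := hmark.2 hmem; omega)
    refine (addRow_spec hn h₁.toEnv h₁.toProgress hi₁ hiT hiD).mono le_rfl
      fun s₂ hf₂ h₂ => ⟨(hf₂.reg _ rfl).trans hi₁, fun h => absurd h hmem, fun _ => ?_⟩
    refine ⟨h₁.toEnv.frame hf₂ rfl, h₂.2 (hM hmem), (hf₂.reg _ rfl).trans h₁.v_eq, ?_⟩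
    rw [Marked, hf₂.arr _ rfl]
    exact h₁.marked
  · have hf₃ := Cmd.frame_eval (c := Cmd.inc rI) rfl s₂
    refine Runs.of_eval rfl ?_ ⟨by simp [Cmd.eval, h₂.1],
      fun h => (h₂.2.1 h).frame hf₃ rfl rfl rfl, fun h => (h₂.2.2 h).frame hf₃ rfl rfl rfl⟩
    rw [storedPotential_congr (hf₃.arr _ rfl) (hf₃.arr _ rfl), add_comm]
    exact le_rfl

/-- The rows below `t` that are not adjacent to `v`. -/
def nonadjacentBelow (S : Finset (Fin m × Fin n)) (v : Fin n) (t : ℕ) : Finset (Fin m) :=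
  univ.filter fun i => (i, v) ∉ S ∧ (i : ℕ) < t

/-- The rows below `t` that are adjacent to `v`. -/
def adjacentBelow (S : Finset (Fin m × Fin n)) (v : Fin n) (t : ℕ) : Finset (Fin m) :=
  univ.filter fun i => (i, v) ∈ S ∧ (i : ℕ) < t

/-- The rows from `t` on that are adjacent to `v`. -/
def adjacentFrom (S : Finset (Fin m × Fin n)) (v : Fin n) (t : ℕ) : Finset (Fin m) :=
  univ.filter fun i => (i, v) ∈ S ∧ t ≤ (i : ℕ)

/-- The rows of `X_W` all miss column `v`, so no set of them is matchable and each of them is kept;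
hence the auction set and the kept set agree at the end. -/
theorem firstRows_spec (hn : 0 < n) {v : Fin n} {s : Store} (h : RoundState L v ∅ ∅ s) :
    Runs (storedPotential L) Cmd.firstRows s (1 + (m * (1 + (20 + 1 + 1) + 1) + 1))
      (RoundState L v (rowsWithin L.toFinset (univ.erase v))
        (rowsWithin L.toFinset (univ.erase v))) := by
  refine Runs.seq (R := fun s' => s'.reg rI = 0)
    (Runs.of_zero (Runs.eval_zero (Q := fun s' => s'.reg rI = 0) rfl (by simp [Cmd.eval]))
      (fun s' hf _ => (storedPotential_congr (hf.arr _ rfl) (hf.arr _ rfl)).le) fun _ _ h => h)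
    fun s₁ hf₁ h0 => ?_
  have h₁ := h.frame hf₁ rfl rfl rfl
  refine (Runs.counter (B := m) (fun t s => RoundState L v (nonadjacentBelow L.toFinset v t)
      (nonadjacentBelow L.toFinset v t) s) h0 h₁.m_eq ?_ ?_).mono le_rfl fun s' _ h => ?_
  · have : nonadjacentBelow L.toFinset v 0 = ∅ := by simp [nonadjacentBelow]
    rwa [this]
  · intro t s ht hi hb h
    let i : Fin m := ⟨t, ht⟩
    have hnot : i ∉ nonadjacentBelow L.toFinset v t := by simp [nonadjacentBelow, i]
    have hstep : ∀ j : Fin m, (j : ℕ) < t + 1 ↔ j = i ∨ (j : ℕ) < t := by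
      intro j
      rw [Fin.ext_iff, Nat.lt_succ_iff_lt_or_eq, or_comm]
    refine (firstRow_spec hn h (i := i) hi hnot hnot fun hmem hM => ?_).mono le_rfl
      fun s' hf h' => ⟨h'.1, ?_, ?_⟩
    · refine not_matchable_rowsWithin (v := v) (hM.mono fun j hj => ?_)
      rw [mem_rowsWithin_erase]
      rcases mem_insert.1 hj with rfl | hj
      · exact hmem
      · exact (mem_filter.1 hj).2.1
    · by_cases hmem : (i, v) ∈ L.toFinset
      · exact (h'.2.1 hmem).m_eq
      · exact (h'.2.2 hmem).m_eq
    · by_cases hmem : (i, v) ∈ L.toFinset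
      · have : nonadjacentBelow L.toFinset v (t + 1) = nonadjacentBelow L.toFinset v t := by
          ext j
          by_cases hj : j = i
          · subst hj; simp only [nonadjacentBelow, mem_filter, hmem]; simp
          · simp [nonadjacentBelow, hstep, hj]
        rw [this]
        exact h'.2.1 hmem
      · have : nonadjacentBelow L.toFinset v (t + 1) =
            insert i (nonadjacentBelow L.toFinset v t) := by
          ext j
          by_cases hj : j = i
          · subst hj; simp only [nonadjacentBelow, mem_filter, hstep, hmem]; simp
          · simp [nonadjacentBelow, hstep, hj]
        rw [this]
        exact h'.2.2 hmem
  · have : nonadjacentBelow L.toFinset v m = rowsWithin L.toFinset (univ.erase v) := by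
      ext j
      rw [mem_rowsWithin_erase]
      simp [nonadjacentBelow]
    rwa [this] at h

/-- The choices `tr` have been made, the rows adjacent to `v` below `t` are in `B ∪ t`, and the
inner loop goes on. -/
def InnerPending (S : Finset (Fin m × Fin n)) (v : Fin n) (t : ℕ) (tr : List (Event m n)) : Prop :=
  ∃ B b : Finset (Fin m), B ∪ b = adjacentBelow S v t ∧ ∀ tr' B',
    InnerLoop S (rowsWithin S (univ.erase v)) B (adjacentFrom S v t) b tr' B' →
      InnerLoop S (rowsWithin S (univ.erase v)) ∅ (rowsWithin S (univ.erase v))ᶜ ∅ (tr ++ tr') B'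

section InnerPending

variable {S : Finset (Fin m × Fin n)} {v : Fin n} {i : Fin m} {tr : List (Event m n)}

theorem adjacentBelow_succ (h : (i, v) ∈ S) :
    adjacentBelow S v (i + 1) = insert i (adjacentBelow S v i) := by
  ext j
  by_cases hj : j = i
  · subst hj; simp [adjacentBelow, h]
  · have : (j : ℕ) < i + 1 ↔ (j : ℕ) < i := by
      have : (j : ℕ) ≠ i := fun h => hj (Fin.ext h)
      omega
    simp only [adjacentBelow, mem_filter, mem_insert, this, hj, false_or]

theorem adjacentFrom_erase : (adjacentFrom S v i).erase i = adjacentFrom S v (i + 1) := by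
  ext j
  by_cases hj : j = i
  · subst hj; simp [adjacentFrom]
  · have : (i : ℕ) + 1 ≤ j ↔ (i : ℕ) ≤ j := by
      have : (j : ℕ) ≠ i := fun h => hj (Fin.ext h)
      omega
    simp only [adjacentFrom, mem_erase, mem_filter, this]
    tauto

theorem adjacentBelow_succ_of_notMem (h : (i, v) ∉ S) :
    adjacentBelow S v (i + 1) = adjacentBelow S v i := by
  ext j
  by_cases hj : j = i
  · subst hj; simp [adjacentBelow, h]
  · have : (j : ℕ) < i + 1 ↔ (j : ℕ) < i := by
      have : (j : ℕ) ≠ i := fun h => hj (Fin.ext h)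
      omega
    simp only [adjacentBelow, mem_filter, this]

/-- A derivation of `InnerLoop` is built from its end, while the machine moves forward.
`InnerPending` therefore turns any completion of the loop into a full run; at the start this is
trivial, since the complement of `X_W` consists of the neighbours of `v`. -/
theorem InnerPending.zero : InnerPending S v 0 [] := by
  refine ⟨∅, ∅, by simp [adjacentBelow], fun tr' B' h => ?_⟩
  have : adjacentFrom S v 0 = (rowsWithin S (univ.erase v))ᶜ := by
    ext j
    rw [mem_compl, mem_rowsWithin_erase]
    simp [adjacentFrom]
  rwa [this] at h

theorem InnerPending.skip (h : InnerPending S v i tr) (hi : (i, v) ∉ S) :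
    InnerPending S v (i + 1) tr := by
  obtain ⟨B, b, hBb, h⟩ := h
  refine ⟨B, b, by rw [adjacentBelow_succ_of_notMem hi, hBb], fun tr' B' h' => h tr' B' ?_⟩
  have hmem : i ∉ adjacentFrom S v i := by simp [adjacentFrom, hi]
  rwa [← adjacentFrom_erase, erase_eq_of_notMem hmem] at h'

theorem InnerPending.choose_aux (hn : 0 < n) (h : InnerPending S v i tr) (hi : (i, v) ∈ S)
    (hM : ¬ Matchable S (rowsWithin S (univ.erase v) ∪ adjacentBelow S v i))
    {tr' : List (Event m n)} {B' : Finset (Fin m)}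
    (h' : InnerLoop S (rowsWithin S (univ.erase v)) (adjacentBelow S v i)
      (adjacentFrom S v (i + 1)) {i} tr' B') :
    InnerLoop S (rowsWithin S (univ.erase v)) ∅ (rowsWithin S (univ.erase v))ᶜ ∅
      (tr ++ [Event.choose i] ++ tr') B' := by
  obtain ⟨B, b, hBb, h⟩ := h
  rw [List.append_assoc]
  refine h _ _ (InnerLoop.step B _ b i tr' B' ?_ (by simp [adjacentFrom, hi]) ?_)
  · rwa [sprank_le_iff hn, union_assoc, hBb]
  · rwa [hBb, adjacentFrom_erase]

theorem InnerPending.choose (hn : 0 < n) (h : InnerPending S v i tr) (hi : (i, v) ∈ S)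
    (hM : ¬ Matchable S (rowsWithin S (univ.erase v) ∪ adjacentBelow S v i)) :
    InnerPending S v (i + 1) (tr ++ [Event.choose i]) :=
  ⟨adjacentBelow S v i, {i}, by rw [adjacentBelow_succ hi, union_comm, insert_eq],
    fun _ _ h' => h.choose_aux hn hi hM h'⟩

/-- The chosen row would complete a matching, so the loop stops without adding it to `B`; the choice
still appears in the transcript. -/
theorem InnerPending.exit (hn : 0 < n) (h : InnerPending S v i tr) (hi : (i, v) ∈ S)
    (hM : ¬ Matchable S (rowsWithin S (univ.erase v) ∪ adjacentBelow S v i))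
    (hM' : Matchable S (insert i (rowsWithin S (univ.erase v) ∪ adjacentBelow S v i))) :
    InnerLoop S (rowsWithin S (univ.erase v)) ∅ (rowsWithin S (univ.erase v))ᶜ ∅
      (tr ++ [Event.choose i]) (adjacentBelow S v i) := by
  rw [← List.append_nil (tr ++ _)]
  refine h.choose_aux hn hi hM (InnerLoop.exit _ _ _ ?_)
  rw [sprank_le_iff hn, not_not, union_comm, ← insert_eq]
  exact hM'

theorem InnerPending.exhausted (hn : 0 < n) (h : InnerPending S v m tr)
    (hM : ¬ Matchable S (rowsWithin S (univ.erase v) ∪ adjacentBelow S v m)) :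
    InnerLoop S (rowsWithin S (univ.erase v)) ∅ (rowsWithin S (univ.erase v))ᶜ ∅
      tr (adjacentBelow S v m) := by
  obtain ⟨B, b, hBb, h⟩ := h
  rw [← List.append_nil tr, ← hBb]
  refine h _ _ ?_
  have : adjacentFrom S v m = ∅ := by
    ext j
    simp [adjacentFrom]
  rw [this]
  refine InnerLoop.exhausted B b ?_
  rwa [sprank_le_iff hn, union_assoc, hBb]

end InnerPending

/-- The state of the machine in the inner loop for the column `v`, when the rows below `t` have
been considered and the choices `tr` have been made. -/
def InnerState (L : List (Fin m × Fin n)) (v : Fin n) (t : ℕ) (tr : List (Event m n))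
    (s : Store) : Prop :=
  (InnerPending L.toFinset v t tr ∧
    ¬ Matchable L.toFinset
      (rowsWithin L.toFinset (univ.erase v) ∪ adjacentBelow L.toFinset v t) ∧
    RoundState L v (rowsWithin L.toFinset (univ.erase v) ∪ adjacentBelow L.toFinset v t)
      (rowsWithin L.toFinset (univ.erase v) ∪ adjacentBelow L.toFinset v t) s) ∨
  ∃ T B : Finset (Fin m), Matchable L.toFinset T ∧
    InnerLoop L.toFinset (rowsWithin L.toFinset (univ.erase v)) ∅
      (rowsWithin L.toFinset (univ.erase v))ᶜ ∅ tr B ∧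
    RoundState L v T (rowsWithin L.toFinset (univ.erase v) ∪ B) s

theorem InnerState.frame {v : Fin n} {t : ℕ} {tr : List (Event m n)} {c : Cmd} {s s' : Store}
    (h : InnerState L v t tr s) (hf : c.Frame s s') (h1 : c.keepsEnv = true)
    (h2 : (c.keepsReg rCur && c.keepsReg rCnt && c.keepsReg rSize &&
      (c.keepsArr aPrice && c.keepsArr aOwner && c.keepsArr aLv && c.keepsArr aPtr &&
        c.keepsArr aIn)) = true)
    (h3 : (c.keepsReg rV && c.keepsArr aMark) = true) : InnerState L v t tr s' := by
  rcases h with ⟨hp, hM, h⟩ | ⟨T, B, hM, hI, h⟩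
  · exact Or.inl ⟨hp, hM, h.frame hf h1 h2 h3⟩
  · exact Or.inr ⟨T, B, hM, hI, h.frame hf h1 h2 h3⟩

theorem InnerState.m_eq {v : Fin n} {t : ℕ} {tr : List (Event m n)} {s : Store}
    (h : InnerState L v t tr s) : s.reg rM = m := by
  rcases h with ⟨-, -, h⟩ | ⟨T, B, -, -, h⟩
  · exact h.toEnv.m_eq
  · exact h.toEnv.m_eq

/-- While the inner loop is pending, the kept rows are unmatchable and the counter is below `n`.
Once it has ended, the counter equals `n`, and the remaining passes over the rows choose nothing. -/
theorem chooseRow_spec (hn : 0 < n) {v : Fin n} {i : Fin m} {tr : List (Event m n)} {s : Store}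
    (h : InnerState L v i tr s) (hi : s.reg rI = i) :
    Runs (storedPotential L) Cmd.chooseRow s (1 + (1 + 20 + 1 + 1 + 1)) fun s' =>
      s'.reg rI = i + 1 ∧ ∃ tr', s'.out = s.out ++ tr'.map Event.code ∧
        InnerState L v (i + 1) (tr ++ tr') s' := by
  refine Runs.seq (R := fun s' => s'.reg rTmp = s.arr aMark i)
    (Runs.of_zero (Runs.eval_zero rfl rfl) (fun s' hf _ => ?_) fun s' _ h => ?_)
    fun s₁ hf₁ htmp => ?_
  · exact (storedPotential_congr (hf.arr _ rfl) (hf.arr _ rfl)).le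
  · subst h
    simp [Cmd.eval, hi]
  have h₁ := h.frame hf₁ rfl rfl rfl
  have hi₁ : s₁.reg rI = i := (hf₁.reg _ rfl).trans hi
  have hz : s₁.reg rZero = 0 := by
    rcases h₁ with ⟨-, -, h⟩ | ⟨T, B, -, -, h⟩ <;> exact h.zero_eq
  have hmark : 0 < s.arr aMark i ↔ (i, v) ∈ L.toFinset := by
    rcases h with ⟨-, -, h⟩ | ⟨T, B, -, -, h⟩ <;> exact h.marked i
  have hout₁ : s₁.out = s.out := hf₁.out rfl
  refine Runs.seq (R := fun s' => s'.reg rI = i ∧ ∃ tr', s'.out = s.out ++ tr'.map Event.code ∧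
        InnerState L v (i + 1) (tr ++ tr') s')
    (Runs.ifLt (fun hlt => Runs.ifLt (fun hcnt => ?_) fun hcnt => ?_) fun hlt => ?_)
    fun s₂ hf₂ h₂ => ?_
  · have hmem : (i, v) ∈ L.toFinset := hmark.1 (by omega)
    rcases h₁ with ⟨hp, hM, h₁⟩ | ⟨T, B, hM, -, h₁⟩
    · refine Runs.seq (R := fun s' => s'.out = s₁.out ++ [(1, (i : ℕ))])
        (Runs.of_zero (Runs.eval_zero rfl rfl) (fun s' hf _ => ?_) fun s' _ h => ?_)
        fun s₂ hf₂ hout₂ => ?_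
      · exact (storedPotential_congr (hf.arr _ rfl) (hf.arr _ rfl)).le
      · subst h
        simp [Cmd.eval, hi₁]
      have h₂ := h₁.frame hf₂ rfl rfl rfl
      have hi₂ : s₂.reg rI = i := (hf₂.reg _ rfl).trans hi₁
      have hnot : i ∉ rowsWithin L.toFinset (univ.erase v) ∪ adjacentBelow L.toFinset v i := by
        rw [mem_union, mem_rowsWithin_erase]
        simp only [adjacentBelow, mem_filter, hmem]
        simp
      refine (addRow_spec hn h₂.toEnv h₂.toProgress hi₂ hnot hnot).mono le_rfl
        fun s₃ hf₃ h₃ => ⟨(hf₃.reg _ rfl).trans hi₂, [Event.choose i], ?_, ?_⟩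
      · rw [hf₃.out rfl, hout₂, hout₁]
        rfl
      have hround : ∀ T D, Progress L T D s₃ → RoundState L v T D s₃ := fun T D hP =>
        ⟨h₂.toEnv.frame hf₃ rfl, hP, (hf₃.reg _ rfl).trans h₂.v_eq,
          by rw [Marked, hf₃.arr _ rfl]; exact h₂.marked⟩
      by_cases hM' : Matchable L.toFinset
          (insert i (rowsWithin L.toFinset (univ.erase v) ∪ adjacentBelow L.toFinset v i))
      · exact Or.inr ⟨_, _, hM', hp.exit hn hmem hM hM', hround _ _ (h₃.1 hM')⟩
      · have hD : insert i (rowsWithin L.toFinset (univ.erase v) ∪ adjacentBelow L.toFinset v i)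
            = rowsWithin L.toFinset (univ.erase v) ∪ adjacentBelow L.toFinset v (i + 1) := by
          rw [adjacentBelow_succ hmem, union_insert]
        have h₄ := hround _ _ (h₃.2 hM')
        rw [hD] at h₄ hM'
        exact Or.inl ⟨hp.choose hn hmem hM, hM', h₄⟩
    -- After the end of the inner loop all columns are owned, contrary to the test just passed.
    · have := (h₁.auction.matchable_iff h₁.cur_eq).1 hM
      have := h₁.n_eq
      omega
  · refine Runs.of_eval rfl (by simp only [Cmd.eval, Cmd.cost]; omega)
      ⟨hi₁, [], by simp [Cmd.eval, hout₁], ?_⟩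
    rw [List.append_nil]
    rcases h₁ with ⟨hp, hM, h₁⟩ | ⟨T, B, hM, hI, h₁⟩
    · have h2 := h₁.auction.cnt_le
      have h3 := h₁.n_eq
      exact absurd ((h₁.auction.matchable_iff h₁.cur_eq).2 (by omega)) hM
    · exact Or.inr ⟨T, B, hM, hI, h₁⟩
  · have hmem : (i, v) ∉ L.toFinset := fun hmem => hlt (by have := hmark.2 hmem; omega)
    refine Runs.of_eval rfl (by simp only [Cmd.eval, Cmd.cost]; omega)
      ⟨hi₁, [], by simp [Cmd.eval, hout₁], ?_⟩
    rw [List.append_nil]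
    rcases h₁ with ⟨hp, hM, h₁⟩ | ⟨T, B, hM, hI, h₁⟩
    · refine Or.inl ⟨hp.skip hmem, ?_, ?_⟩
      · rwa [adjacentBelow_succ_of_notMem hmem]
      · rwa [adjacentBelow_succ_of_notMem hmem]
    · exact Or.inr ⟨T, B, hM, hI, h₁⟩
  · have hf₃ := Cmd.frame_eval (c := Cmd.inc rI) rfl s₂
    obtain ⟨hi₂, tr', hout₂, h₂⟩ := h₂
    refine Runs.of_eval rfl ?_ ⟨by simp [Cmd.eval, hi₂], tr', by rw [hf₃.out rfl, hout₂],
      h₂.frame hf₃ rfl rfl rfl⟩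
    rw [storedPotential_congr (hf₃.arr _ rfl) (hf₃.arr _ rfl), add_comm]
    exact le_rfl

theorem chooseRows_spec (hn : 0 < n) {v : Fin n} {s : Store}
    (h : RoundState L v (rowsWithin L.toFinset (univ.erase v))
      (rowsWithin L.toFinset (univ.erase v)) s) :
    Runs (storedPotential L) Cmd.chooseRows s (1 + (m * (1 + (1 + 20 + 1 + 1 + 1) + 1) + 1))
      fun s' => ∃ (tr : List (Event m n)) (T B : Finset (Fin m)),
        s'.out = s.out ++ tr.map Event.code ∧
        InnerLoop L.toFinset (rowsWithin L.toFinset (univ.erase v)) ∅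
          (rowsWithin L.toFinset (univ.erase v))ᶜ ∅ tr B ∧
        RoundState L v T (rowsWithin L.toFinset (univ.erase v) ∪ B) s' := by
  refine Runs.seq (R := fun s' => s'.reg rI = 0)
    (Runs.of_zero (Runs.eval_zero (Q := fun s' => s'.reg rI = 0) rfl (by simp [Cmd.eval]))
      (fun s' hf _ => (storedPotential_congr (hf.arr _ rfl) (hf.arr _ rfl)).le) fun _ _ h => h)
    fun s₁ hf₁ h0 => ?_
  have h₁ := h.frame hf₁ rfl rfl rfl
  refine (Runs.counter (B := m) (fun t s' => ∃ tr, s'.out = s.out ++ tr.map Event.code ∧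
    InnerState L v t tr s') h0 h₁.toEnv.m_eq ?_ ?_).mono le_rfl fun s' _ h => ?_
  · have h0 : adjacentBelow L.toFinset v 0 = ∅ := by simp [adjacentBelow]
    refine ⟨[], by simp [hf₁.out rfl], Or.inl ⟨InnerPending.zero, ?_, ?_⟩⟩
    · rw [h0, union_empty]; exact not_matchable_rowsWithin
    · rwa [h0, union_empty]
  · rintro t s' ht hi hb ⟨tr, hout, h⟩
    refine (chooseRow_spec hn (i := ⟨t, ht⟩) h hi).mono le_rfl ?_
    rintro s'' hf ⟨hi', tr', hout', h'⟩
    exact ⟨hi', h'.m_eq, tr ++ tr', by rw [hout', hout, List.map_append, List.append_assoc], h'⟩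
  · obtain ⟨tr, hout, ⟨hp, hM, h⟩ | ⟨T, B, -, hI, h⟩⟩ := h
    · exact ⟨tr, _, _, hout, hp.exhausted hn hM, h⟩
    · exact ⟨tr, T, B, hout, hI, h⟩

/-- The set `Xf` is stored as the best candidate. -/
def Best (Xf : Finset (Fin m)) (s : Store) : Prop :=
  s.reg rBest = Xf.card ∧ ∀ i : Fin m, s.arr aBest i = if i ∈ Xf then 1 else 0

theorem Best.frame {Xf : Finset (Fin m)} {c : Cmd} {s s' : Store} (h : Best Xf s)
    (hf : c.Frame s s') (hc : (c.keepsReg rBest && c.keepsArr aBest) = true) : Best Xf s' := by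
  rw [Bool.and_eq_true] at hc
  rw [Best, hf.reg _ hc.1, hf.arr _ hc.2]
  exact h

theorem endRound_spec {T D Xf : Finset (Fin m)} {v : Fin n} {s : Store}
    (h : RoundState L v T D s) (hX : Best Xf s) :
    Runs (fun _ => 0) Cmd.endRound s ((1 + (1 + (m * (Cmd.copyRow.cost + 1) + 1)) + 1) + 1)
      fun s' => s'.reg rV = v + 1 ∧ Best (if Xf.card < D.card then D else Xf) s' := by
  have hsize := h.size_eq
  have hbest := hX.1
  refine Runs.seq (R := fun s' => s'.reg rV = v ∧ Best (if Xf.card < D.card then D else Xf) s')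
    (Runs.ifLt (fun hlt => ?_) fun hlt => ?_) fun s₁ hf₁ h₁ => ?_
  · rw [hsize, hbest] at hlt
    rw [if_pos hlt]
    refine Runs.seq (R := fun s' => s'.reg rBest = D.card)
      (Runs.eval_zero rfl (by simp [Cmd.eval, hsize])) fun s₁ hf₁ h₁ => ?_
    refine (copyRows_spec (h.toEnv.frame hf₁ rfl)).mono le_rfl fun s₂ hf₂ h₂ => ⟨?_, ?_, ?_⟩
    · rw [hf₂.reg _ rfl, hf₁.reg _ rfl, h.v_eq]
    · rw [hf₂.reg _ rfl, h₁]
    · intro i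
      rw [h₂ i i.2, hf₁.arr _ rfl]
      exact h.mem_iff i
  · rw [hsize, hbest] at hlt
    rw [if_neg hlt]
    exact Runs.of_eval rfl (by simp only [Cmd.cost]; omega) ⟨h.v_eq, hX⟩
  · exact Runs.eval_zero rfl ⟨by simp [Cmd.eval, h₁.1],
      h₁.2.frame (Cmd.frame_eval (c := Cmd.inc rV) rfl s₁) rfl⟩

end

/-! ### All rounds, the output and the total time -/

section

variable {m n : ℕ} {L : List (Fin m × Fin n)}

/-- The direct work is linear in `m + n + |L|`, and the auctions of the round cost at most a
constant times `(2 * n + 1) * |L|`. With `n ≤ m` and `0 < m`, both are absorbed by `m * (1 + |L|)`;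
the constants are generous. -/
theorem round_spec (hn : 0 < n) (hnm : n ≤ m) {Xf : Finset (Fin m)} {v : Fin n} {s : Store}
    (hE : Env L s) (hv : s.reg rV = v) (hX : Best Xf s) :
    Runs (fun _ => 0) Cmd.round s (270 * (m * (1 + L.length)))
      fun s' => s'.reg rV = v + 1 ∧ ∃ (tr : List (Event m n)) (B : Finset (Fin m)),
        s'.out = s.out ++ (Event.round v :: tr).map Event.code ∧
        InnerLoop L.toFinset (rowsWithin L.toFinset (univ.erase v)) ∅
          (rowsWithin L.toFinset (univ.erase v))ᶜ ∅ tr B ∧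
        Best (if Xf.card < (rowsWithin L.toFinset (univ.erase v) ∪ B).card then
          rowsWithin L.toFinset (univ.erase v) ∪ B else Xf) s' := by
  have key := Runs.seq (startRound_spec hE hv) (d := Cmd.seq Cmd.firstRows
    (Cmd.seq Cmd.chooseRows Cmd.endRound)) (L := 60 * m + 20 + 50 * ((2 * n + 1) * L.length))
    (Q := fun s' => s'.reg rV = v + 1 ∧ ∃ (tr : List (Event m n)) (B : Finset (Fin m)),
        s'.out = s.out ++ (Event.round v :: tr).map Event.code ∧
        InnerLoop L.toFinset (rowsWithin L.toFinset (univ.erase v)) ∅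
          (rowsWithin L.toFinset (univ.erase v))ᶜ ∅ tr B ∧
        Best (if Xf.card < (rowsWithin L.toFinset (univ.erase v) ∪ B).card then
          rowsWithin L.toFinset (univ.erase v) ∪ B else Xf) s') ?_
  · refine key.mono ?_ fun _ _ h => h
    have c1 : Cmd.resetRow.cost = 7 := rfl
    have c2 : Cmd.resetCol.cost = 4 := rfl
    have c3 : Cmd.markEdge.cost = 10 := rfl
    have c4 : Cmd.clearCounters.cost = 4 := rfl
    rw [c1, c2, c3, c4]
    have h1 : n * L.length ≤ m * L.length := Nat.mul_le_mul_right _ hnm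
    have h2 : L.length ≤ m * L.length := Nat.le_mul_of_pos_left _ (by omega)
    have h3 : (2 * n + 1) * L.length = 2 * (n * L.length) + L.length := by ring
    have h4 : m * (1 + L.length) = m + m * L.length := by ring
    omega
  · rintro s₁ hf₁ ⟨h₁, hout₁, hpot⟩
    have hX₁ := hX.frame hf₁ rfl
    refine Runs.to_zero (Φ := storedPotential L) (K := 60 * m + 20) ?_ ?_
    · refine (Runs.seq (firstRows_spec hn h₁) fun s₂ hf₂ h₂ =>
        Runs.seq (chooseRows_spec hn h₂) fun s₃ hf₃ h₃ => ?_).mono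
        (L := 60 * m + 20) (K := (1 + (m * (1 + (20 + 1 + 1) + 1) + 1)) +
          ((1 + (m * (1 + (1 + 20 + 1 + 1 + 1) + 1) + 1)) +
            (((1 + (1 + (m * (Cmd.copyRow.cost + 1) + 1)) + 1) + 1)))) ?_ fun _ _ h => h
      · obtain ⟨tr, T, B, hout₃, hI, h₃⟩ := h₃
        have hX₃ := (hX₁.frame hf₂ rfl).frame hf₃ rfl
        refine (endRound_spec h₃ hX₃).of_zero (fun s' hf _ =>
          (storedPotential_congr (hf.arr _ rfl) (hf.arr _ rfl)).le) fun s₄ hf₄ h₄ =>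
          ⟨h₄.1, tr, B, ?_, hI, h₄.2⟩
        rw [hf₄.out rfl, hout₃, hf₂.out rfl, hout₁]
        simp [Event.code]
      · have c1 : Cmd.copyRow.cost = 4 := rfl
        rw [c1]
        omega
    · rw [hpot]
      -- The decided inequality says that one auction step with its test costs at most `50`.
      exact Nat.add_le_add_left (Nat.mul_le_mul_right _ (by decide)) _

/-- The sets `W` for the columns from `t` on. -/
def remaining (n t : ℕ) : Finset (Finset (Fin n)) :=
  (univ.filter fun v : Fin n => t ≤ (v : ℕ)).image univ.erase

theorem mem_remaining {t : ℕ} {v : Fin n} : univ.erase v ∈ remaining n t ↔ t ≤ (v : ℕ) := by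
  simp only [remaining, mem_image, mem_filter, mem_univ, true_and]
  constructor
  · rintro ⟨w, hw, h⟩
    have : w = v := by
      by_contra hne
      have : w ∈ univ.erase v := mem_erase.2 ⟨hne, mem_univ _⟩
      rw [← h] at this
      exact absurd rfl (mem_erase.1 this).1
    rwa [← this]
  · exact fun h => ⟨v, h, rfl⟩

theorem remaining_zero (hn : 0 < n) : remaining n 0 = powersetCard (n - 1) univ := by
  ext W
  rw [mem_powersetCard]
  constructor
  · intro h
    obtain ⟨v, -, rfl⟩ := mem_image.1 h
    simp
  · rintro ⟨-, h⟩
    have hc : Wᶜ.card = 1 := by rw [card_compl, h, Fintype.card_fin]; omega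
    obtain ⟨v, hv⟩ := card_eq_one.1 hc
    refine mem_image.2 ⟨v, by simp, ?_⟩
    rw [← compl_singleton, ← hv, compl_compl]

theorem remaining_erase (v : Fin n) :
    (remaining n v).erase (univ.erase v) = remaining n (v + 1) := by
  ext W
  constructor
  · intro h
    obtain ⟨hne, h⟩ := mem_erase.1 h
    obtain ⟨w, hw, rfl⟩ := mem_image.1 h
    have hw := (mem_filter.1 hw).2
    rw [mem_remaining]
    have : (w : ℕ) ≠ v := fun h => hne (by rw [Fin.ext h])
    omega
  · intro h
    obtain ⟨w, hw, rfl⟩ := mem_image.1 h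
    have hw := (mem_filter.1 hw).2
    refine mem_erase.2 ⟨fun h => ?_, mem_remaining.2 (by omega)⟩
    have := mem_remaining (t := w) (v := v)
    rw [← h, mem_remaining] at this
    omega

theorem remaining_self : remaining n n = ∅ := by
  rw [remaining, image_eq_empty, filter_eq_empty_iff]
  intro v _
  omega

/-- The choices that have been output lead to the candidate that is stored, and the columns from
`t` on remain. -/
def OuterState (L : List (Fin m × Fin n)) (t : ℕ) (s : Store) : Prop :=
  ∃ (tr : List (Event m n)) (Xf : Finset (Fin m)), s.out = tr.map Event.code ∧ Best Xf s ∧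
    ∀ tr' Xf', OuterLoop L.toFinset (remaining n t) Xf tr' Xf' →
      AlgorithmRun L.toFinset (tr ++ tr') Xf'

theorem rounds_spec (hn : 0 < n) (hnm : n ≤ m) {s : Store} (hE : Env L s) (hv : s.reg rV = 0)
    (hbest : s.reg rBest = 0) (hzero : ∀ i, s.arr aBest i = 0) (hout : s.out = []) :
    Runs (fun _ => 0) (Cmd.whileLt rV rN Cmd.round) s
      (n * (270 * (m * (1 + L.length)) + 1) + 1)
      fun s' => ∃ (tr : List (Event m n)) (Xf : Finset (Fin m)),
        s'.out = tr.map Event.code ∧ Best Xf s' ∧ AlgorithmRun L.toFinset tr Xf := by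
  refine (Runs.counter (B := n) (fun t s => Env L s ∧ OuterState L t s) hv hE.n_eq
    ⟨hE, [], ∅, hout, ⟨by rw [hbest, card_empty], fun i => by simp [hzero]⟩, ?_⟩ ?_).mono le_rfl ?_
  · intro tr' Xf' h
    rwa [remaining_zero hn] at h
  · rintro t s ht hi hb ⟨hE, tr, Xf, hout, hX, hrun⟩
    refine (round_spec hn hnm (v := ⟨t, ht⟩) hE hi hX).mono le_rfl ?_
    rintro s' hf ⟨hv', tr₁, B, hout', hI, hX'⟩
    have hE' := hE.frame hf rfl
    refine ⟨hv', hE'.n_eq, hE', tr ++ Event.round ⟨t, ht⟩ :: tr₁, _,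
      by rw [hout', hout, List.map_append], hX', fun tr' Xf' h => ?_⟩
    rw [List.append_assoc, List.cons_append]
    -- As in the inner loop, the state holds a continuation, which absorbs the round just completed.
    refine hrun _ _ (OuterLoop.step _ _ _ _ _ _ _ _ (mem_remaining.2 le_rfl) rfl hI ?_)
    have hrem := remaining_erase (⟨t, ht⟩ : Fin n)
    simp only at hrem
    rw [hrem]
    exact h
  · rintro s' hf ⟨hE', tr, Xf, hout', hX, hrun⟩
    refine ⟨tr, Xf, hout', hX, ?_⟩
    rw [← List.append_nil tr]
    refine hrun _ _ ?_
    rw [remaining_self]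
    exact OuterLoop.done Xf

/-- The machine has no subtraction of registers, so `rM` is decremented once for each row that is
output. Since this changes `rM`, the loop bound is first copied to `rLen`. -/
theorem output_spec {Xf : Finset (Fin m)} {s : Store} (hE : Env L s) (hX : Best Xf s) :
    Runs (fun _ => 0) Cmd.output s (3 + (m * (Cmd.outputRow.cost + 1) + 1)) fun s' =>
      s'.reg rM = m - Xf.card ∧ ∃ R : List (Fin m), R.Nodup ∧ R.toFinset = Xf ∧
        s'.out = s.out ++ R.map fun i => (2, (i : ℕ)) := by
  have hm := hE.m_eq
  have hz := hE.zero_eq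
  refine Runs.seq (R := fun s' => s' = (Cmd.block [Cmd.copy rLen rM, Cmd.const rI 0]).eval s)
    (Runs.eval_zero rfl rfl) ?_
  rintro _ - rfl
  refine (Runs.counter (B := m) (fun t s' => s'.reg rZero = 0 ∧ s'.arr aBest = s.arr aBest ∧
    ∃ R : List (Fin m), R.Nodup ∧ R.toFinset = Xf.filter (fun i : Fin m => (i : ℕ) < t) ∧
      s'.reg rM = m - R.length ∧ s'.out = s.out ++ R.map fun i => (2, (i : ℕ))) ?_ ?_ ?_ ?_).mono
    le_rfl ?_
  · simp [Cmd.block, Cmd.eval]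
  · simp [Cmd.block, Cmd.eval, hm]
  · exact ⟨by simp [Cmd.block, Cmd.eval, hz], by simp [Cmd.block, Cmd.eval], [], by simp, by simp,
      by simp [Cmd.block, Cmd.eval, hm], by simp [Cmd.block, Cmd.eval]⟩
  · rintro t s' ht hi hb ⟨hz, hbest, R, hnd, hR, hreg, hout⟩
    have hmem : s'.arr aBest t = if (⟨t, ht⟩ : Fin m) ∈ Xf then 1 else 0 := by
      rw [hbest]; exact hX.2 ⟨t, ht⟩
    have hlt : ∀ j : Fin m, (j : ℕ) < t + 1 ↔ (j : ℕ) < t ∨ j = ⟨t, ht⟩ := by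
      intro j
      rw [Fin.ext_iff, Nat.lt_succ_iff_lt_or_eq]
    by_cases hin : (⟨t, ht⟩ : Fin m) ∈ Xf
    · rw [if_pos hin] at hmem
      refine Runs.eval_zero rfl ⟨?_, ?_, ?_, ?_, R ++ [⟨t, ht⟩], ?_, ?_, ?_, ?_⟩
      · simp [Cmd.outputRow, Cmd.block, Cmd.eval, hi, hmem, hz]
      · simp [Cmd.outputRow, Cmd.block, Cmd.eval, hi, hmem, hz, hb]
      · simp [Cmd.outputRow, Cmd.block, Cmd.eval, hi, hmem, hz]
      · simp [Cmd.outputRow, Cmd.block, Cmd.eval, hi, hmem, hz, hbest]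
      · rw [List.nodup_append]
        refine ⟨hnd, List.nodup_singleton _, fun a ha b hb hab => ?_⟩
        rw [List.mem_singleton] at hb
        subst hab hb
        have := List.mem_toFinset.2 ha
        rw [hR] at this
        exact lt_irrefl _ (mem_filter.1 this).2
      · ext j
        rw [List.toFinset_append, hR, mem_union, mem_filter, mem_filter, hlt, List.mem_toFinset,
          List.mem_singleton]
        constructor
        · rintro (⟨h1, h2⟩ | rfl)
          · exact ⟨h1, Or.inl h2⟩
          · exact ⟨hin, Or.inr rfl⟩
        · tauto
      · simp [Cmd.outputRow, Cmd.block, Cmd.eval, hi, hmem, hz, hreg]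
        omega
      · simp [Cmd.outputRow, Cmd.block, Cmd.eval, hi, hmem, hz, hout]
    · rw [if_neg hin] at hmem
      refine Runs.eval_zero rfl ⟨?_, ?_, ?_, ?_, R, hnd, ?_, ?_, ?_⟩
      · simp [Cmd.outputRow, Cmd.block, Cmd.eval, hi, hmem, hz]
      · simp [Cmd.outputRow, Cmd.block, Cmd.eval, hi, hmem, hz, hb]
      · simp [Cmd.outputRow, Cmd.block, Cmd.eval, hi, hmem, hz]
      · simp [Cmd.outputRow, Cmd.block, Cmd.eval, hi, hmem, hz, hbest]
      · ext j
        rw [hR, mem_filter, mem_filter, hlt]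
        constructor
        · tauto
        · rintro ⟨h1, h2 | rfl⟩
          · exact ⟨h1, h2⟩
          · exact absurd h1 hin
      · simp [Cmd.outputRow, Cmd.block, Cmd.eval, hi, hmem, hz, hreg]
      · simp [Cmd.outputRow, Cmd.block, Cmd.eval, hi, hmem, hz, hout]
  · rintro s' - ⟨-, -, R, hnd, hR, hreg, hout⟩
    have hR' : R.toFinset = Xf := by
      rw [hR, filter_true_of_mem]
      exact fun i _ => i.2
    exact ⟨by rw [hreg, ← hR', List.toFinset_card_of_nodup hnd], R, hnd, hR', hout⟩

theorem program_spec (hn : 0 < n) (hnm : n ≤ m) (L : List (Fin m × Fin n)) :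
    ∃ (k : ℕ) (tr : List (Event m n)) (Xf : Finset (Fin m)),
      k ≤ 400 * (n * m * (1 + L.length)) ∧ CarriesOutRun Cmd.program L.toFinset L k tr Xf := by
  have hrun : Runs (fun _ => 0) Cmd.program (inputStore L) (400 * (n * m * (1 + L.length)))
      fun s => ∃ (tr : List (Event m n)) (Xf : Finset (Fin m)), AlgorithmRun L.toFinset tr Xf ∧
        ∃ R : List (Fin m), R.Nodup ∧ R.toFinset = Xf ∧
          s.out = tr.map Event.code ++ R.map (fun i => (2, (i : ℕ))) ∧
          s.reg rM = m - Xf.card := by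
    refine (Runs.seq linkEdges_spec fun s₁ hf₁ hE₁ =>
      Runs.seq (rounds_spec hn hnm hE₁ ?_ ?_ ?_ ?_) fun s₂ hf₂ h₂ => ?_).mono
      (K := (1 + (L.length * (Cmd.linkEdge.cost + 1) + 1)) +
        ((n * (270 * (m * (1 + L.length)) + 1) + 1) +
          (3 + (m * (Cmd.outputRow.cost + 1) + 1)))) ?_ fun _ _ h => h
    · rw [hf₁.reg _ rfl]; rfl
    · rw [hf₁.reg _ rfl]; rfl
    · intro i; rw [hf₁.arr _ rfl]; rfl
    · rw [hf₁.out rfl]; rfl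
    · obtain ⟨tr, Xf, hout, hX, hrun⟩ := h₂
      refine (output_spec (hE₁.frame hf₂ rfl) hX).mono le_rfl ?_
      rintro s₃ - ⟨hreg, R, hnd, hR, hout'⟩
      exact ⟨tr, Xf, hrun, R, hnd, hR, by rw [hout', hout], hreg⟩
    · have c1 : Cmd.linkEdge.cost = 8 := rfl
      have c2 : Cmd.outputRow.cost ≤ 9 := by decide
      have h1 : m * (Cmd.outputRow.cost + 1) ≤ m * 10 := Nat.mul_le_mul_left _ (by omega)
      have h2 : n * (270 * (m * (1 + L.length)) + 1) = 270 * (n * m * (1 + L.length)) + n := by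
        ring
      have h3 : n * m * (1 + L.length) = n * m + n * m * L.length := by ring
      have hpos : 0 < n * m := Nat.mul_pos hn (by omega)
      have h4 : L.length ≤ n * m * L.length := Nat.le_mul_of_pos_left _ hpos
      have h5 : m ≤ n * m := Nat.le_mul_of_pos_left _ hn
      rw [c1]
      omega
  obtain ⟨k, s, he, hk, tr, Xf, hA, R, h⟩ := hrun
  exact ⟨k, tr, Xf, hk, hA, s, R, he, h⟩

end

end GenericCospark

theorem theorem4 :
    -- every run of the algorithm, whatever choices it makes, returns the generic cospark
    (∀ (m n : ℕ), 0 < n → ∀ (S : Finset (Fin m × Fin n))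
      (tr : List (GenericCospark.Event m n)) (Xf : Finset (Fin m)),
      GenericCospark.AlgorithmRun S tr Xf →
        ((m - Xf.card : ℕ) : ℕ∞) = GenericCospark.spcospark S) ∧
    -- the algorithm can be carried out in time `O(n m (1 + |S|))`
    (∃ (P : GenericCospark.Cmd) (C : ℕ), ∀ (m n : ℕ), 0 < n → n ≤ m →
      ∀ (S : Finset (Fin m × Fin n)) (L : List (Fin m × Fin n)), L.Nodup → L.toFinset = S →
        ∃ (k : ℕ) (tr : List (GenericCospark.Event m n)) (Xf : Finset (Fin m)),
          k ≤ C * (n * m * (1 + S.card)) ∧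
          GenericCospark.CarriesOutRun P S L k tr Xf ∧
          ((m - Xf.card : ℕ) : ℕ∞) = GenericCospark.spcospark S) ∧
    -- the generic cospark is computable in time polynomial in `m` and `n`
    (∃ (P : GenericCospark.Cmd) (p : Polynomial ℕ), ∀ (m n : ℕ), 0 < n → n ≤ m →
      ∀ (S : Finset (Fin m × Fin n)) (L : List (Fin m × Fin n)), L.Nodup → L.toFinset = S →
        ∃ (k : ℕ) (s : GenericCospark.Store),
          k ≤ p.eval (m + n) ∧
          GenericCospark.Exec P (GenericCospark.inputStore L) k s ∧
          (s.reg 0 : ℕ∞) = GenericCospark.spcospark S) := by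
  refine ⟨fun m n hn S tr Xf h => h.spcospark_eq hn, ⟨GenericCospark.Cmd.program, 400, ?_⟩,
    -- Both `n * m` and the number of positions are at most `(m + n) ^ 2`.
    GenericCospark.Cmd.program, 400 * (Polynomial.X ^ 2 * (1 + Polynomial.X ^ 2)), ?_⟩
  · rintro m n hn hnm S L hL rfl
    obtain ⟨k, tr, Xf, hk, h⟩ := GenericCospark.program_spec hn hnm L
    rw [List.toFinset_card_of_nodup hL]
    exact ⟨k, tr, Xf, hk, h, h.1.spcospark_eq hn⟩
  · rintro m n hn hnm S L hL rfl
    obtain ⟨k, tr, Xf, hk, hA, s, R, he, -, -, -, hreg⟩ :=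
      GenericCospark.program_spec hn hnm L
    refine ⟨k, s, hk.trans ?_, he, by rw [hreg]; exact hA.spcospark_eq hn⟩
    have hlen : L.length ≤ m * n := by
      have := Finset.card_le_univ L.toFinset
      rwa [List.toFinset_card_of_nodup hL, Fintype.card_prod, Fintype.card_fin,
        Fintype.card_fin] at this
    have hmn : m * n ≤ (m + n) ^ 2 := by nlinarith
    simp only [Polynomial.eval_mul, Polynomial.eval_add, Polynomial.eval_pow, Polynomial.eval_X,
      Polynomial.eval_one, Polynomial.eval_ofNat]
    rw [mul_comm n m]
    gcongr
    exact hlen.trans hmn
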